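/- Let $0<\alpha<1$ and $T>0$. For an absolutely continuous function $x:[0,T]\to\mathbb C$, let $${}^C\!D^\alpha x(t)=\frac1{\Gamma(1-\alpha)}\int_0^t (t-\tau)^{-\alpha}x'(\tau)\,d\tau$$ be its Caputo derivative, and let ${}^L\!D^\alpha x(t)={}^C\!D^\alpha x(t)/{}^C\!D^\alpha t$ for $t\in(0,T]$ (defined for almost every $t$) be its L-fractional derivative; when $x$ is given by a power series in $t$, put ${}^L\!D^\alpha x(0)=x'(0)$. Write ${}^L\!D^{k\circ\alpha}$ for the $k$-fold composition of ${}^L\!D^\alpha$. Let $$\mathcal E_\alpha(s)=\sum_{n=0}^\infty \frac{s^n}{\Gamma(2-\alpha)^n\prod_{j=1}^n\frac{\Gamma(j+1)}{\Gamma(j+1-\alpha)}},\qquad s\in\mathbb C,$$ and let $\mathcal E_\alpha^{(k)}$ be its ordinary $k$-th derivative. Let $m\ge1$ and $a_0,\dots,a_{m-1}\in\mathbb C$, and write $$\lambda^m+a_{m-1}\lambda^{m-1}+\dots+a_1\lambda+a_0=\prod_{l=1}^r(\lambda-\lambda_l)^{n_l}$$ with distinct $\lambda_1,\dots,\lambda_r\in\mathbb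 C$ and $n_l\ge1$. Let $\mathcal S$ be the set of all solutions $x:[0,T]\to\mathbb C$ of $${}^L\!D^{m\circ\alpha}x+a_{m-1}\,{}^L\!D^{(m-1)\circ\alpha}x+\dots+a_1\,{}^L\!D^{\alpha}x+a_0x=0,$$ that is, of all $x$ for which there are absolutely continuous functions $y_0=x,y_1,\dots,y_{m-1}$ on $[0,T]$ and a function $y_m$ on $[0,T]$ with ${}^L\!D^\alpha y_k=y_{k+1}$ almost everywhere for $0\le k<m$ and $y_m+\sum_{k=0}^{m-1}a_ky_k=0$ almost everywhere. Then the functions $$t^k\,\mathcal E_\alpha^{(k)}(\lambda_l t)\quad(t\in[0,T]),\qquad 1\le l\le r,\ 0\le k<n_l,$$ form a basis of $\mathcal S$ as a complex vector space: they are linearly independent, and their linear span is $\mathcal S$. They are equally a basis of the space of those $x$ that are given on $[0,T]$ by an absolutely convergent power series in $t$ and satisfy the equation at every $t\in[0,T]$; thus the two solution spaces coincide. -/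

import Mathlib

namespace LFractional

open MeasureTheory Set

noncomputable section

/-- The Caputo derivative of order `α` with base point `0`:
`(1 / Γ(1 - α)) ∫₀ᵗ (t - τ)^(-α) x'(τ) dτ`. -/
def caputoDeriv (α : ℝ) (x : ℝ → ℂ) (t : ℝ) : ℂ :=
  ((1 / Real.Gamma (1 - α) : ℝ) : ℂ) *
    ∫ τ in (0 : ℝ)..t, (((t - τ) ^ (-α) : ℝ) : ℂ) * deriv x τ

/-- The L-fractional derivative of a function `x : [0,T] → ℂ`: the quotient of the Caputo
derivative of `x` by the Caputo derivative of the identity function for `t ∈ (0,T]`, and the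
one-sided derivative `x'(0)` at `t = 0` (its continuous extension for smooth `x`).
Inside the integral only the values of `x` on `[0,t]` matter; `IccExtend` turns `x` into a
function on the line. -/
def lDeriv {T : ℝ} (hT : 0 < T) (α : ℝ) (x : Icc (0 : ℝ) T → ℂ) : Icc (0 : ℝ) T → ℂ :=
  fun t =>
    if (t : ℝ) = 0 then derivWithin (IccExtend hT.le x) (Icc 0 T) 0
    else caputoDeriv α (IccExtend hT.le x) t / caputoDeriv α (fun s : ℝ => (s : ℂ)) t

/-- The Mittag-Leffler-type function
`𝓔_α(s) = ∑ₙ sⁿ / (Γ(2-α)ⁿ ∏_{j=1}^n Γ(j+1)/Γ(j+1-α))`, an entire function for `0 < α < 1`. -/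
def mittagLefflerL (α : ℝ) (s : ℂ) : ℂ :=
  ∑' n : ℕ, s ^ n /
    ((Real.Gamma (2 - α) ^ n *
      ∏ j ∈ Finset.Icc 1 n, Real.Gamma ((j : ℝ) + 1) / Real.Gamma ((j : ℝ) + 1 - α) : ℝ) : ℂ)

/-- The function `t ↦ t^k 𝓔_α^{(k)}(μ t)` on `[0,T]`, where `𝓔_α^{(k)}` is the ordinary `k`-th
derivative of `𝓔_α`. -/
def basisFun (T α : ℝ) (μ : ℂ) (k : ℕ) : Icc (0 : ℝ) T → ℂ :=
  fun t => ((t : ℝ) : ℂ) ^ k * iteratedDeriv k (mittagLefflerL α) (μ * ((t : ℝ) : ℂ))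

/-- The solutions `x : [0,T] → ℂ` of the sequential equation
`D^{m∘α} x + a_{m-1} D^{(m-1)∘α} x + ⋯ + a_1 D^α x + a_0 x = 0`, in the class of absolutely
continuous functions and the almost-everywhere sense: `y k` stands for `D^{k∘α} x`, each `y k`
with `k < m` is absolutely continuous on `[0,T]` (so that its L-fractional derivative makes sense
almost everywhere), `y (k+1)` is the L-fractional derivative of `y k` almost everywhere, and the
equation holds almost everywhere. -/
def solutions {T : ℝ} (hT : 0 < T) (α : ℝ) {m : ℕ} (a : Fin m → ℂ) :
    Set (Icc (0 : ℝ) T → ℂ) :=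
  {x | ∃ y : ℕ → Icc (0 : ℝ) T → ℂ,
    y 0 = x ∧
    (∀ k < m, AbsolutelyContinuousOnInterval (IccExtend hT.le (y k)) 0 T) ∧
    (∀ k < m, ∀ᵐ t ∂(volume.comap (Subtype.val : Icc (0 : ℝ) T → ℝ)),
      lDeriv hT α (y k) t = y (k + 1) t) ∧
    ∀ᵐ t ∂(volume.comap (Subtype.val : Icc (0 : ℝ) T → ℝ)),
      y m t + ∑ i : Fin m, a i * y i t = 0}

/-- The solutions that are given on `[0,T]` by an (absolutely convergent) power series in `t` and satisfy the sequential
equation at every `t ∈ [0,T]`, the higher derivatives being the iterates of `lDeriv`. -/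
def analyticSolutions {T : ℝ} (hT : 0 < T) (α : ℝ) {m : ℕ} (a : Fin m → ℂ) :
    Set (Icc (0 : ℝ) T → ℂ) :=
  {x | (∃ c : ℕ → ℂ, ∀ t : Icc (0 : ℝ) T, HasSum (fun n => c n * ((t : ℝ) : ℂ) ^ n) (x t)) ∧
    ∀ t : Icc (0 : ℝ) T,
      ((lDeriv hT α)^[m] x) t + ∑ i : Fin m, a i * ((lDeriv hT α)^[(i : ℕ)] x) t = 0}

end

end LFractional

/-! On power series the L-fractional derivative sends `t ^ n`, `n ≥ 1`, to `ratio α n * t ^ (n -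
1)`. Writing a series as `∑ b n / weight α n * t ^ n`, where `weight` is the product of these
ratios, turns the operator into the left shift of `b`, and the equation into the recurrence `b (n +
m) + ∑ i, a i * b (n + i) = 0`. The bound `ratio α (n + 1) ≤ n + 1` keeps the radius of convergence
under the operator, and `ratio → ∞` makes the relevant series entire.

The recurrence is solved by the `k`-th derivatives of `X ^ n` at the roots of the characteristic
polynomial, `k` below the multiplicity. Hermite interpolation makes these sequences independent, and
counting dimensions makes them a basis. Their weighted series are exactly `t ^ k * 𝓔^{(k)}(λ t)`
(`hasSum_basisFun`), and the identity theorem on `[0, T)` carries independence and the recurrence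
between sequences and functions. This settles the power series class.

For absolutely continuous solutions uniqueness remains. Abel's inversion (`abel_inversion`) rewrites
`D y = V` as a Volterra equation with kernel `(t - s) ^ (α - 1) * s ^ (1 - α)`, and a Gronwall
inequality for this weakly singular kernel (`abel_gronwall`) shows that the values `y k 0`, `k < m`,
determine the solution (`chain_unique`). Every such set of values is attained by an entire solution,
so there are no others. -/

namespace LFractional

/-! ### Linear recurrences with multiple characteristic roots -/

section Recurrence

/-- The values `(d/dX)^k X^n` at `μ`: the sequences that solve a linear recurrence whose
characteristic polynomial has `μ` as a root of multiplicity greater than `k`. -/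
noncomputable def confluentSeq (μ : ℂ) (k n : ℕ) : ℂ := (n.descFactorial k : ℂ) * μ ^ (n - k)

/-- The linear recurrence `b (n + m) + ∑ i, a i * b (n + i) = 0`. -/
noncomputable def recurrence {m : ℕ} (a : Fin m → ℂ) : LinearRecurrence ℂ := ⟨m, fun i => -a i⟩

open Polynomial

lemma recurrence_isSolution_iff {m : ℕ} (a : Fin m → ℂ) (b : ℕ → ℂ) :
    (recurrence a).IsSolution b ↔ ∀ n, b (n + m) + ∑ i : Fin m, a i * b (n + i) = 0 := by
  refine forall_congr' fun n => ?_
  change b (n + m) = ∑ i : Fin m, -a i * b (n + i) ↔ _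
  simp only [neg_mul, Finset.sum_neg_distrib]
  exact eq_neg_iff_add_eq_zero

lemma eval_iterate_derivative_X_pow (μ : ℂ) (k n : ℕ) :
    (derivative^[k] (X ^ n : ℂ[X])).eval μ = confluentSeq μ k n := by
  simp [iterate_derivative_X_pow_eq_smul, confluentSeq]

section

variable {m : ℕ} {a : Fin m → ℂ} {r : ℕ} {μ : Fin r → ℂ} {n : Fin r → ℕ}

/-- With `p` the characteristic polynomial, `X ^ N * p` vanishes at `μ l` to order at least `n l >
k`, so its `k`-th derivative is zero there; expanding it monomial by monomial gives the recurrence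
at `N`. -/
lemma confluentSeq_isSolution
    (hp : (X ^ m + ∑ i : Fin m, C (a i) * X ^ (i : ℕ) : ℂ[X]) = ∏ l : Fin r, (X - C (μ l)) ^ n l)
    (l : Fin r) {k : ℕ} (hk : k < n l) : (recurrence a).IsSolution (confluentSeq (μ l) k) := by
  rw [recurrence_isSolution_iff]
  intro N
  have hne : (X ^ N * ∏ l : Fin r, (X - C (μ l)) ^ n l : ℂ[X]) ≠ 0 :=
    mul_ne_zero (pow_ne_zero _ X_ne_zero)
      (Finset.prod_ne_zero_iff.2 fun i _ => pow_ne_zero _ (X_sub_C_ne_zero _))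
  have hroot : k < (X ^ N * ∏ l : Fin r, (X - C (μ l)) ^ n l : ℂ[X]).rootMultiplicity (μ l) :=
    hk.trans_le <| (le_rootMultiplicity_iff hne).2 <|
      (Finset.dvd_prod_of_mem (fun l => (X - C (μ l)) ^ n l) (Finset.mem_univ l)).mul_left _
  have h := isRoot_iterate_derivative_of_lt_rootMultiplicity hroot
  rw [IsRoot, ← hp, mul_add, ← pow_add, Finset.mul_sum, iterate_map_add,
    iterate_derivative_sum, eval_add, eval_finsetSum, eval_iterate_derivative_X_pow] at h
  rw [← h]
  congr 1
  refine Finset.sum_congr rfl fun i _ => ?_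
  rw [mul_left_comm, ← pow_add, iterate_derivative_C_mul, eval_mul, eval_C,
    eval_iterate_derivative_X_pow]

lemma sum_multiplicities_eq
    (hp : (X ^ m + ∑ i : Fin m, C (a i) * X ^ (i : ℕ) : ℂ[X]) =
      ∏ l : Fin r, (X - C (μ l)) ^ n l) : ∑ l, n l = m := by
  have hdeg : (∑ i : Fin m, C (a i) * X ^ (i : ℕ) : ℂ[X]).degree < m :=
    degree_sum_fin_lt a
  have h1 : (X ^ m + ∑ i : Fin m, C (a i) * X ^ (i : ℕ) : ℂ[X]).natDegree = m := by
    refine natDegree_eq_of_degree_eq_some ?_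
    rw [degree_add_eq_left_of_degree_lt] <;> simp [hdeg]
  rw [← h1, hp, natDegree_prod_of_monic _ _ fun l _ => (monic_X_sub_C _).pow _]
  simp

/-- Hermite interpolation: a polynomial of degree less than `m` is determined by its jets. -/
lemma eq_zero_of_jets_eq_zero (hμ : Function.Injective μ) (hm : ∑ l, n l = m)
    {P : ℂ[X]} (hP : P.degree < m)
    (h : ∀ l, ∀ k < n l, (derivative^[k] P).eval (μ l) = 0) : P = 0 := by
  by_contra hne
  have hdvd : (∏ l : Fin r, (X - C (μ l)) ^ n l) ∣ P := by
    refine Finset.prod_dvd_of_coprime (fun i _ j _ hij => ?_) fun l _ => ?_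
    · exact (pairwise_coprime_X_sub_C hμ hij).pow
    · rw [← le_rootMultiplicity_iff hne]
      -- The subtraction in `n l - 1` truncates, so multiplicity zero is treated apart.
      rcases Nat.eq_zero_or_pos (n l) with h0 | h0
      · omega
      · have := (lt_rootMultiplicity_iff_isRoot_iterate_derivative (n := n l - 1) (t := μ l)
          hne).2 fun k hk => h l k (by omega)
        omega
  have hle := degree_le_of_dvd hdvd hne
  rw [degree_prod] at hle
  have : ∑ l : Fin r, ((X - C (μ l)) ^ n l).degree = (m : WithBot ℕ) := by
    simp [← hm]
  rw [this] at hle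
  exact absurd (hle.trans_lt hP) (lt_irrefl _)

/-- Duality with Hermite interpolation: the jet map on polynomials of degree less than `m` is
injective between spaces of equal dimension, hence onto. A relation among the sequences, summed
against the coefficients of `P`, is a relation among the jets of `P`. -/
lemma linearIndependent_confluentSeq (hμ : Function.Injective μ) (hm : ∑ l, n l = m) :
    LinearIndependent ℂ
      (fun p : (Σ l : Fin r, Fin (n l)) => confluentSeq (μ p.1) p.2) := by
  classical
  let J : degreeLT ℂ m →ₗ[ℂ] ((Σ l : Fin r, Fin (n l)) → ℂ) :=
    LinearMap.pi fun p => (leval (μ p.1)) ∘ₗ (derivative ^ (p.2 : ℕ)) ∘ₗ (degreeLT ℂ m).subtype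
  have hJ : ∀ P p, J P p = (derivative^[(p.2 : ℕ)] (P : ℂ[X])).eval (μ p.1) := fun P p => by
    simp [J, Module.End.pow_apply]
  have hinj : Function.Injective J := by
    rw [← LinearMap.ker_eq_bot, LinearMap.ker_eq_bot']
    rintro ⟨P, hPm⟩ hP
    refine Subtype.ext (eq_zero_of_jets_eq_zero hμ hm (mem_degreeLT.1 hPm) fun l k hk => ?_)
    simpa [hJ] using congrFun hP ⟨l, ⟨k, hk⟩⟩
  have : FiniteDimensional ℂ (degreeLT ℂ m) := (degreeLTEquiv ℂ m).symm.finiteDimensional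
  have hsurj : Function.Surjective J := by
    refine (LinearMap.injective_iff_surjective_of_finrank_eq_finrank ?_).1 hinj
    rw [(degreeLTEquiv ℂ m).finrank_eq]
    simp [hm]
  rw [Fintype.linearIndependent_iff]
  intro g hg q
  -- The jets of this `P` are all zero except the one at `q`, so it isolates `g q`.
  obtain ⟨⟨P, hPm⟩, hP⟩ := hsurj (Pi.single q 1)
  have key : ∑ p, g p * J ⟨P, hPm⟩ p = 0 := by
    have hE : ∀ p : (Σ l : Fin r, Fin (n l)), J ⟨P, hPm⟩ p =
        ∑ N ∈ P.support, P.coeff N * confluentSeq (μ p.1) p.2 N := fun p => by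
      rw [hJ]
      conv_lhs => rw [show ((⟨P, hPm⟩ : degreeLT ℂ m) : ℂ[X]) = P from rfl,
        P.as_sum_support_C_mul_X_pow]
      rw [iterate_derivative_sum, eval_finsetSum]
      simp [iterate_derivative_C_mul, ← eval_iterate_derivative_X_pow]
    simp_rw [hE, Finset.mul_sum]
    rw [Finset.sum_comm]
    refine Finset.sum_eq_zero fun N _ => ?_
    have := congrFun hg N
    simp only [Finset.sum_apply, Pi.smul_apply, smul_eq_mul, Pi.zero_apply] at this
    simp_rw [mul_left_comm (g _), ← Finset.mul_sum, this, mul_zero]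
  simpa [hP, Pi.single_apply] using key

/-- The confluent sequences span the solutions of the recurrence. -/
lemma exists_eq_sum_confluentSeq (hμ : Function.Injective μ)
    (hp : (X ^ m + ∑ i : Fin m, C (a i) * X ^ (i : ℕ) : ℂ[X]) = ∏ l : Fin r, (X - C (μ l)) ^ n l)
    {b : ℕ → ℂ} (hb : (recurrence a).IsSolution b) :
    ∃ g : (Σ l : Fin r, Fin (n l)) → ℂ, ∑ p, g p • confluentSeq (μ p.1) p.2 = b := by
  have hm := sum_multiplicities_eq hp
  let v : (Σ l : Fin r, Fin (n l)) → (recurrence a).solSpace := fun p =>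
    ⟨confluentSeq (μ p.1) p.2, confluentSeq_isSolution hp p.1 p.2.2⟩
  have hv : LinearIndependent ℂ v :=
    LinearIndependent.of_comp (recurrence a).solSpace.subtype
      (linearIndependent_confluentSeq hμ hm)
  have : FiniteDimensional ℂ (recurrence a).solSpace :=
    (recurrence a).toInit.symm.finiteDimensional
  have hspan := hv.span_eq_top_of_card_eq_finrank' (by
    rw [(recurrence a).toInit.finrank_eq, Module.finrank_fin_fun]
    simp [hm, recurrence])
  have hmem : (⟨b, hb⟩ : (recurrence a).solSpace) ∈ Submodule.span ℂ (Set.range v) :=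
    hspan ▸ Submodule.mem_top
  obtain ⟨g, hg⟩ := (Submodule.mem_span_range_iff_exists_fun ℂ).1 hmem
  refine ⟨g, ?_⟩
  have := congrArg (recurrence a).solSpace.subtype hg
  simpa [v] using this

end

end Recurrence

/-! ### Power series: differentiation and the identity theorem -/

open MeasureTheory Set

/-- The coefficients `c` define a power series converging absolutely on the disc of radius `R`. -/
def ConvergesOn (R : ℝ) (c : ℕ → ℂ) : Prop := ∀ s : ℝ, 0 ≤ s → s < R → Summable fun n => ‖c n‖ * s ^ n

/-- The formal derivative of a power series. -/
def derivCoeff (c : ℕ → ℂ) : ℕ → ℂ := fun n => ((n : ℂ) + 1) * c (n + 1)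

lemma ConvergesOn.natCast_mul {R : ℝ} {c : ℕ → ℂ} (hc : ConvergesOn R c) :
    ConvergesOn R fun n => (n : ℂ) * c n := by
  intro s hs hsR
  -- At the larger radius `s'` the terms are bounded, and the geometric factor `(s / s') ^ n`
  -- absorbs `n`.
  obtain ⟨s', hss', hs'R⟩ := exists_between hsR
  have hs' : 0 < s' := hs.trans_lt hss'
  obtain ⟨M, hM⟩ := (hc s' hs'.le hs'R).tendsto_atTop_zero.bddAbove_range
  have hq : ‖s / s'‖ < 1 := by
    rw [Real.norm_of_nonneg (by positivity), div_lt_one hs']; exact hss'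
  refine Summable.of_nonneg_of_le (fun n => by positivity) (fun n => ?_)
    ((summable_pow_mul_geometric_of_norm_lt_one 1 hq).mul_left M)
  have hn : ‖c n‖ * s' ^ n ≤ M := hM ⟨n, rfl⟩
  calc ‖(n : ℂ) * c n‖ * s ^ n = (‖c n‖ * s' ^ n) * ((n : ℝ) ^ 1 * (s / s') ^ n) := by
        rw [norm_mul, Complex.norm_natCast, div_pow]
        field_simp
    _ ≤ _ := by gcongr

lemma ConvergesOn.mono_norm {R : ℝ} {c d : ℕ → ℂ} (hd : ConvergesOn R d)
    (h : ∀ n, ‖c n‖ ≤ ‖d n‖) : ConvergesOn R c := fun s hs hsR =>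
  Summable.of_nonneg_of_le (fun n => by positivity)
    (fun n => mul_le_mul_of_nonneg_right (h n) (by positivity)) (hd s hs hsR)

lemma ConvergesOn.shift {R : ℝ} {c : ℕ → ℂ} (hc : ConvergesOn R c) :
    ConvergesOn R fun n => c (n + 1) := by
  intro s hs hsR
  obtain ⟨s', hss', hs'R⟩ := exists_between hsR
  have hs' : 0 < s' := hs.trans_lt hss'
  have h1 := ((summable_nat_add_iff 1).2 (hc s' hs'.le hs'R)).mul_left s'⁻¹
  refine Summable.of_nonneg_of_le (fun n => by positivity) (fun n => ?_) h1
  calc ‖c (n + 1)‖ * s ^ n ≤ ‖c (n + 1)‖ * s' ^ n := by gcongr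
    _ = _ := by rw [pow_succ]; field_simp

lemma ConvergesOn.formalDeriv {R : ℝ} {c : ℕ → ℂ} (hc : ConvergesOn R c) :
    ConvergesOn R (derivCoeff c) :=
  hc.natCast_mul.shift.mono_norm fun n => by simp [derivCoeff]

lemma ConvergesOn.summable {R : ℝ} {c : ℕ → ℂ} (hc : ConvergesOn R c) {z : ℂ} (hz : ‖z‖ < R) :
    Summable fun n => c n * z ^ n :=
  Summable.of_norm (by simpa using hc ‖z‖ (norm_nonneg z) hz)

lemma ConvergesOn.hasDerivAt {R : ℝ} {c : ℕ → ℂ} (hc : ConvergesOn R c) {z : ℂ} (hz : ‖z‖ < R) :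
    HasDerivAt (fun w => ∑' n, c n * w ^ n) (∑' n, derivCoeff c n * z ^ n) z := by
  obtain ⟨s, hzs, hsR⟩ := exists_between hz
  have hs : 0 ≤ s := (norm_nonneg z).trans hzs.le
  have hsum : Summable fun n : ℕ => ‖c n‖ * n * s ^ (n - 1) := by
    rw [← summable_nat_add_iff 1]
    refine (hc.formalDeriv s hs hsR).congr fun n => ?_
    simp only [derivCoeff, norm_mul, Nat.add_sub_cancel]
    rw [show (n : ℂ) + 1 = ((n + 1 : ℕ) : ℂ) by push_cast; rfl, Complex.norm_natCast]
    ring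
  have h := hasDerivAt_tsum_of_isPreconnected (g := fun n w => c n * w ^ n)
    (g' := fun n w => c n * (n * w ^ (n - 1))) (y₀ := z) hsum Metric.isOpen_ball
    (convex_ball (0 : ℂ) s).isPreconnected
    (fun n y _ => (hasDerivAt_pow n y).const_mul _) (fun n y hy => ?_)
    (mem_ball_zero_iff.2 hzs) (hc.summable hz) (mem_ball_zero_iff.2 hzs)
  · have hs' : Summable fun n : ℕ => c n * (n * z ^ (n - 1)) := by
      refine Summable.of_norm_bounded hsum fun n => ?_
      rw [norm_mul, norm_mul, norm_pow, Complex.norm_natCast, ← mul_assoc]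
      gcongr
    rw [hs'.tsum_eq_zero_add] at h
    simp only [Nat.cast_zero, zero_mul, mul_zero, zero_add, Nat.add_sub_cancel] at h
    convert! h using 1
    refine tsum_congr fun n => ?_
    simp only [derivCoeff]
    push_cast
    ring
  · rw [norm_mul, norm_mul, norm_pow, Complex.norm_natCast, ← mul_assoc]
    have : ‖y‖ ≤ s := (mem_ball_zero_iff.1 hy).le
    gcongr

lemma ConvergesOn.hasDerivAt_real {R : ℝ} {c : ℕ → ℂ} (hc : ConvergesOn R c) {t : ℝ}
    (ht : |t| < R) :
    HasDerivAt (fun s : ℝ => ∑' n, c n * (s : ℂ) ^ n) (∑' n, derivCoeff c n * (t : ℂ) ^ n) t :=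
  (hc.hasDerivAt (z := t) (by simpa using ht)).comp_ofReal

lemma iteratedDeriv_tsum_pow {c : ℕ → ℂ} (hc : ∀ R, ConvergesOn R c) (k : ℕ) (z : ℂ) :
    iteratedDeriv k (fun w => ∑' n, c n * w ^ n) z = ∑' n, (derivCoeff^[k] c) n * z ^ n := by
  induction k generalizing c with
  | zero => simp
  | succ k ih =>
    rw [iteratedDeriv_succ', Function.iterate_succ_apply, ← ih fun R => (hc R).formalDeriv]
    congr 1
    funext w
    exact ((hc (‖w‖ + 1)).hasDerivAt (by linarith)).deriv

lemma iterate_derivCoeff (c : ℕ → ℂ) (k n : ℕ) :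
    (derivCoeff^[k] c) n = ((n + k).descFactorial k : ℂ) * c (n + k) := by
  induction k generalizing c n with
  | zero => simp
  | succ k ih =>
    rw [Function.iterate_succ_apply, ih, derivCoeff, ← mul_assoc]
    have : ((n + (k + 1)).descFactorial (k + 1) : ℂ) =
        ((n + k).descFactorial k : ℂ) * ((n + k : ℕ) + 1) := by
      rw [← add_assoc, Nat.succ_descFactorial_succ]; push_cast; ring
    rw [this, add_assoc]

/-- The value at `0` kills `c 0`. For `t > 0` one may divide by `t`, and continuity restores the
value at `0` of the shifted series, so the induction applies to the shift. -/
lemma ConvergesOn.eq_zero {R : ℝ} (hR : 0 < R) {c : ℕ → ℂ} (hc : ConvergesOn R c)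
    (h : ∀ t : ℝ, 0 ≤ t → t < R → ∑' n, c n * (t : ℂ) ^ n = 0) (n : ℕ) : c n = 0 := by
  have h0 : ∀ d : ℕ → ℂ, ∑' n, d n * ((0 : ℝ) : ℂ) ^ n = d 0 := fun d => by
    rw [tsum_eq_single 0 fun k hk => by simp [hk]]; simp
  induction n generalizing c with
  | zero => rw [← h0 c]; exact h 0 le_rfl hR
  | succ n ih =>
    have hc0 : c 0 = 0 := by rw [← h0 c]; exact h 0 le_rfl hR
    have hpos : ∀ t : ℝ, 0 < t → t < R → ∑' n, c (n + 1) * (t : ℂ) ^ n = 0 := by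
      intro t ht htR
      have h1 := h t ht.le htR
      rw [(hc.summable (z := t) (by simpa [abs_of_pos ht] using htR)).tsum_eq_zero_add] at h1
      simp only [hc0, zero_mul, zero_add, pow_succ, ← mul_assoc] at h1
      rw [tsum_mul_right] at h1
      exact (mul_eq_zero.1 h1).resolve_right (by exact_mod_cast ht.ne')
    refine ih (c := fun n => c (n + 1)) hc.shift fun t ht htR => ?_
    rcases ht.eq_or_lt with rfl | ht
    · have hcont : ContinuousWithinAt (fun s : ℝ => ∑' n, c (n + 1) * (s : ℂ) ^ n) (Ioi 0) 0 :=
        (hc.shift.hasDerivAt_real (by simpa using hR)).continuousAt.continuousWithinAt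
      refine tendsto_nhds_unique hcont (tendsto_const_nhds.congr' ?_)
      filter_upwards [Ioo_mem_nhdsGT hR] with t ht
      exact (hpos t ht.1 ht.2).symm
    · exact hpos t ht htR

/-! ### The Beta integral, the weights and their growth -/

/-- The real Beta integral on `[0, t]`. -/
lemma integral_rpow_mul_rpow {a b t : ℝ} (ha : 0 < a) (hb : 0 < b) (ht : 0 < t) :
    ∫ s in (0 : ℝ)..t, s ^ (a - 1) * (t - s) ^ (b - 1) =
      t ^ (a + b - 1) * ProbabilityTheory.beta a b := by
  have h := Complex.betaIntegral_scaled a b ht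
  have hbeta : Complex.betaIntegral a b = (ProbabilityTheory.beta a b : ℝ) := by
    rw [Complex.betaIntegral_eq_Gamma_mul_div _ _ (by simpa) (by simpa), ProbabilityTheory.beta,
      ← Complex.ofReal_add, Complex.Gamma_ofReal, Complex.Gamma_ofReal, Complex.Gamma_ofReal]
    norm_cast
  apply Complex.ofReal_injective
  rw [← intervalIntegral.integral_ofReal, Complex.ofReal_mul, ← hbeta,
    Complex.ofReal_cpow ht.le]
  push_cast
  rw [← h]
  refine intervalIntegral.integral_congr fun s hs => ?_
  rw [uIcc_of_le ht.le] at hs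
  rw [Complex.ofReal_cpow hs.1, Complex.ofReal_cpow (by linarith [hs.2])]
  push_cast
  rfl

lemma intervalIntegrable_sub_rpow {b : ℝ} (hb : -1 < b) (t u v : ℝ) :
    IntervalIntegrable (fun s : ℝ => (t - s) ^ b) volume u v := by
  have := (intervalIntegral.intervalIntegrable_rpow' (a := t - u) (b := t - v) hb).comp_sub_left t
  simpa using this

/-- The factor by which the L-fractional derivative multiplies the monomial `t ^ n`. -/
noncomputable def ratio (α : ℝ) (n : ℕ) : ℝ :=
  Real.Gamma (2 - α) * (Real.Gamma ((n : ℝ) + 1) / Real.Gamma ((n : ℝ) + 1 - α))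

/-- The product of the factors `ratio α j`, `1 ≤ j ≤ n`. -/
noncomputable def weight (α : ℝ) (n : ℕ) : ℝ :=
  Real.Gamma (2 - α) ^ n *
    ∏ j ∈ Finset.Icc 1 n, Real.Gamma ((j : ℝ) + 1) / Real.Gamma ((j : ℝ) + 1 - α)

lemma weight_zero (α : ℝ) : weight α 0 = 1 := by simp [weight]

lemma weight_succ (α : ℝ) (n : ℕ) : weight α (n + 1) = weight α n * ratio α (n + 1) := by
  rw [weight, weight, ratio, Finset.prod_Icc_succ_top (by omega)]
  ring

lemma ratio_pos {α : ℝ} (hα1 : α < 1) (n : ℕ) : 0 < ratio α n := by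
  have hn : (0 : ℝ) ≤ n := n.cast_nonneg
  exact mul_pos (Real.Gamma_pos_of_pos (by linarith)) (div_pos (Real.Gamma_pos_of_pos (by linarith))
    (Real.Gamma_pos_of_pos (by linarith)))

lemma weight_pos {α : ℝ} (hα1 : α < 1) (n : ℕ) : 0 < weight α n := by
  induction n with
  | zero => simp [weight_zero]
  | succ n ih => rw [weight_succ]; exact mul_pos ih (ratio_pos hα1 _)

lemma ratio_one {α : ℝ} (hα1 : α < 1) : ratio α 1 = 1 := by
  have := (Real.Gamma_pos_of_pos (s := 2 - α) (by linarith)).ne'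
  rw [ratio, show ((1 : ℕ) : ℝ) + 1 = 2 by norm_num, Real.Gamma_two]
  field_simp

/-- This makes the L-fractional derivative of a series dominated coefficientwise by its ordinary
derivative, so convergence is preserved. The induction multiplies by `(n + 2) / (n + 2 - α)`, which
is at most `(n + 2) / (n + 1)`. -/
lemma ratio_succ_le {α : ℝ} (hα0 : 0 < α) (hα1 : α < 1) (n : ℕ) : ratio α (n + 1) ≤ n + 1 := by
  induction n with
  | zero => simp [ratio_one hα1]
  | succ n ih =>
    have hn : (0 : ℝ) ≤ n := n.cast_nonneg
    have h1 : ratio α (n + 1 + 1) = ratio α (n + 1) * (((n : ℝ) + 2) / (n + 2 - α)) := by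
      have hG := (Real.Gamma_pos_of_pos (s := (n : ℝ) + 2 - α) (by linarith)).ne'
      have hne : (n : ℝ) + 2 - α ≠ 0 := by linarith
      rw [ratio, ratio]
      push_cast
      rw [show (n : ℝ) + 1 + 1 + 1 - α = (n + 2 - α) + 1 by ring,
        show (n : ℝ) + 1 + 1 - α = n + 2 - α by ring, Real.Gamma_add_one hne,
        Real.Gamma_add_one (s := (n : ℝ) + 1 + 1) (by positivity)]
      field_simp
      ring
    rw [h1]
    push_cast
    calc ratio α (n + 1) * (((n : ℝ) + 2) / (n + 2 - α))
        ≤ (n + 1) * (((n : ℝ) + 2) / (n + 2 - α)) := by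
          have : (0 : ℝ) ≤ ((n : ℝ) + 2) / (n + 2 - α) :=
            div_nonneg (by linarith) (by linarith)
          gcongr
      _ ≤ n + 1 + 1 := by
          rw [mul_div_assoc', div_le_iff₀ (by linarith)]
          nlinarith

/-- Log-convexity of Gamma between `n` and `n + 1` gives `Γ(n + 1 - α) ≤ n ^ (1 - α) * Γ(n)`. -/
lemma le_ratio {α : ℝ} (hα0 : 0 < α) (hα1 : α < 1) {n : ℕ} (hn : 1 ≤ n) :
    Real.Gamma (2 - α) * (n : ℝ) ^ α ≤ ratio α n := by
  have hn' : (0 : ℝ) < n := by exact_mod_cast hn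
  have hG := Real.Gamma_pos_of_pos hn'
  have h := Real.Gamma_mul_add_mul_le_rpow_Gamma_mul_rpow_Gamma (s := (n : ℝ) + 1) (t := n)
    (a := 1 - α) (b := α) (by linarith) hn' (by linarith) hα0 (by ring)
  rw [show (1 - α) * ((n : ℝ) + 1) + α * n = n + 1 - α by ring, Real.Gamma_add_one hn'.ne',
    Real.mul_rpow hn'.le hG.le, mul_assoc, ← Real.rpow_add hG, sub_add_cancel, Real.rpow_one] at h
  refine mul_le_mul_of_nonneg_left ?_ (Real.Gamma_pos_of_pos (by linarith)).le
  rw [le_div_iff₀ (Real.Gamma_pos_of_pos (by linarith)), Real.Gamma_add_one hn'.ne']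
  calc (n : ℝ) ^ α * Real.Gamma (n + 1 - α)
      ≤ (n : ℝ) ^ α * ((n : ℝ) ^ (1 - α) * Real.Gamma n) := by gcongr
    _ = n * Real.Gamma n := by
      rw [← mul_assoc, ← Real.rpow_add hn', add_sub_cancel, Real.rpow_one]

lemma tendsto_ratio {α : ℝ} (hα0 : 0 < α) (hα1 : α < 1) :
    Filter.Tendsto (fun n => ratio α n) Filter.atTop Filter.atTop := by
  refine Filter.tendsto_atTop_mono' _ ?_
    (((tendsto_rpow_atTop hα0).comp tendsto_natCast_atTop_atTop).const_mul_atTop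
      (Real.Gamma_pos_of_pos (s := 2 - α) (by linarith)))
  filter_upwards [Filter.eventually_ge_atTop 1] with n hn
  exact le_ratio hα0 hα1 hn

lemma summable_pow_div_weight {α : ℝ} (hα0 : 0 < α) (hα1 : α < 1) (s : ℝ) :
    Summable fun n => s ^ n / weight α n := by
  rcases eq_or_ne s 0 with rfl | hs
  · exact summable_of_ne_finset_zero (s := {0}) fun n hn => by simp_all
  refine summable_of_ratio_test_tendsto_lt_one zero_lt_one
    (Filter.Eventually.of_forall fun n => div_ne_zero (pow_ne_zero _ hs) (weight_pos hα1 n).ne') ?_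
  have h := ((Filter.tendsto_add_atTop_iff_nat 1).2 (tendsto_ratio hα0 hα1)).const_div_atTop |s|
  refine h.congr fun n => ?_
  have h1 := weight_pos hα1 n
  have h2 := ratio_pos hα1 (n + 1)
  rw [weight_succ, norm_div, norm_div, norm_mul, norm_pow, norm_pow, Real.norm_of_nonneg h1.le,
    Real.norm_of_nonneg h2.le, Real.norm_eq_abs, pow_succ]
  have := abs_pos.2 hs
  field_simp

lemma ConvergesOn.natCast_pow_mul {R : ℝ} {c : ℕ → ℂ} (hc : ConvergesOn R c) (k : ℕ) :
    ConvergesOn R fun n => (n : ℂ) ^ k * c n := by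
  induction k with
  | zero => simpa using hc
  | succ k ih => simpa [pow_succ', mul_assoc] using ih.natCast_mul

/-- The power series with coefficients `confluentSeq μ k n / weight α n` is entire. -/
lemma convergesOn_confluentSeq {α : ℝ} (hα0 : 0 < α) (hα1 : α < 1) (μ : ℂ) (k : ℕ) (R : ℝ) :
    ConvergesOn R fun n => confluentSeq μ k n / (weight α n : ℂ) := by
  -- The base `1 + ‖μ‖` is at least `1`, so the exponent `n - k` can be raised to `n`; the falling
  -- factorial costs only `n ^ k`.
  have h : ConvergesOn R fun n => (((1 + ‖μ‖) ^ n / weight α n : ℝ) : ℂ) := by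
    intro s _ _
    refine (summable_pow_div_weight hα0 hα1 ((1 + ‖μ‖) * s)).congr fun n => ?_
    rw [Complex.norm_real, Real.norm_of_nonneg
      (div_nonneg (by positivity) (weight_pos hα1 n).le), mul_pow]
    ring
  refine (h.natCast_pow_mul k).mono_norm fun n => ?_
  have hw := weight_pos hα1 n
  rw [norm_div, norm_mul, Complex.norm_real, Complex.norm_real, norm_pow, Complex.norm_natCast,
    confluentSeq, norm_mul, Complex.norm_natCast, norm_pow, norm_div, Real.norm_of_nonneg hw.le,
    Real.norm_of_nonneg (by positivity), mul_div_assoc]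
  have h1 : (n.descFactorial k : ℝ) ≤ (n : ℝ) ^ k := by exact_mod_cast Nat.descFactorial_le_pow n k
  have h2 : ‖μ‖ ^ (n - k) ≤ (1 + ‖μ‖) ^ n :=
    (pow_le_pow_left₀ (norm_nonneg _) (by linarith) _).trans
      (pow_le_pow_right₀ (by linarith [norm_nonneg μ]) (Nat.sub_le n k))
  gcongr

lemma mittagLefflerL_eq (α : ℝ) :
    mittagLefflerL α = fun s => ∑' n, ((weight α n : ℂ))⁻¹ * s ^ n := by
  funext s
  simp only [mittagLefflerL, weight, div_eq_inv_mul]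

/-- Differentiating `k` times shifts the index down by `k` and the factor `t ^ k` shifts it back.
The `k` missing initial terms are zero because `n.descFactorial k = 0` for `n < k`. -/
lemma hasSum_basisFun {α : ℝ} (hα0 : 0 < α) (hα1 : α < 1) (T : ℝ) (μ : ℂ) (k : ℕ)
    (t : Icc (0 : ℝ) T) :
    HasSum (fun n => confluentSeq μ k n / (weight α n : ℂ) * ((t : ℝ) : ℂ) ^ n)
      (basisFun T α μ k t) := by
  have hsum := (convergesOn_confluentSeq hα0 hα1 μ k (‖((t : ℝ) : ℂ)‖ + 1)).summable
    (z := ((t : ℝ) : ℂ)) (by linarith)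
  convert! hsum.hasSum using 1
  have hent : ∀ R, ConvergesOn R fun n => ((weight α n : ℂ))⁻¹ := fun R =>
    (convergesOn_confluentSeq hα0 hα1 1 0 R).mono_norm fun n => by simp [confluentSeq]
  rw [basisFun, mittagLefflerL_eq, iteratedDeriv_tsum_pow hent, ← hsum.sum_add_tsum_nat_add k,
    Finset.sum_eq_zero, zero_add, ← tsum_mul_left]
  · refine tsum_congr fun n => ?_
    rw [iterate_derivCoeff, confluentSeq, Nat.add_sub_cancel, mul_pow, pow_add]
    ring
  · intro n hn
    simp [confluentSeq, Nat.descFactorial_of_lt (Finset.mem_range.1 hn)]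

/-! ### The L-fractional derivative on power series -/

/-- The fractional integral of a monomial. -/
lemma integral_sub_rpow_mul_pow {α t : ℝ} (hα1 : α < 1) (ht : 0 < t) (n : ℕ) :
    ∫ τ in (0 : ℝ)..t, (((t - τ) ^ (-α) : ℝ) : ℂ) * (τ : ℂ) ^ n =
      ((t ^ n * t ^ (1 - α) * ProbabilityTheory.beta (n + 1) (1 - α) : ℝ) : ℂ) := by
  have h := integral_rpow_mul_rpow (a := n + 1) (b := 1 - α) (by positivity) (by linarith) ht
  rw [show (n : ℝ) + 1 + (1 - α) - 1 = n + (1 - α) by ring, Real.rpow_add ht,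
    Real.rpow_natCast] at h
  rw [← h, ← intervalIntegral.integral_ofReal]
  refine intervalIntegral.integral_congr fun s _ => ?_
  rw [add_sub_cancel_right, Real.rpow_natCast, show 1 - α - 1 = -α by ring]
  push_cast
  ring

lemma caputoDeriv_id {α t : ℝ} (hα1 : α < 1) (ht : 0 < t) :
    caputoDeriv α (fun s : ℝ => (s : ℂ)) t = ((t ^ (1 - α) / Real.Gamma (2 - α) : ℝ) : ℂ) := by
  have hd : deriv (fun s : ℝ => (s : ℂ)) = fun _ => 1 := by
    funext s
    simpa using (hasDerivAt_id (s : ℂ)).comp_ofReal.deriv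
  have h := integral_sub_rpow_mul_pow hα1 ht 0
  simp only [pow_zero, mul_one, one_mul] at h
  simp only [caputoDeriv, hd, mul_one]
  rw [h, ProbabilityTheory.beta, ← Complex.ofReal_mul]
  have := (Real.Gamma_pos_of_pos (s := 1 - α) (by linarith)).ne'
  congr 1
  rw [show ((0 : ℕ) : ℝ) + 1 = 1 by norm_num, show 1 + (1 - α) = 2 - α by ring, Real.Gamma_one]
  field_simp

/-- Termwise Caputo differentiation of a power series. -/
lemma hasSum_caputoDeriv {α t R : ℝ} (hα1 : α < 1) (ht : 0 < t) (htR : t < R) {c : ℕ → ℂ}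
    (hc : ConvergesOn R c) {f : ℝ → ℂ}
    (hf : ∀ s ∈ Ioo 0 t, f s = ∑' n, c n * (s : ℂ) ^ n) :
    HasSum (fun n => ((1 / Real.Gamma (1 - α) : ℝ) : ℂ) * (derivCoeff c n *
      ((t ^ n * t ^ (1 - α) * ProbabilityTheory.beta (n + 1) (1 - α) : ℝ) : ℂ)))
      (caputoDeriv α f t) := by
  refine HasSum.mul_left _ ?_
  have hd := hc.formalDeriv t ht.le htR
  -- The majorant is integrable in `τ` because `α < 1`, and summable in `n` because `t < R`.
  have h := intervalIntegral.hasSum_integral_of_dominated_convergence (μ := volume) (a := 0)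
    (b := t) (F := fun n τ => (((t - τ) ^ (-α) : ℝ) : ℂ) * (derivCoeff c n * (τ : ℂ) ^ n))
    (f := fun τ => (((t - τ) ^ (-α) : ℝ) : ℂ) * deriv f τ)
    (fun n τ => (t - τ) ^ (-α) * (‖derivCoeff c n‖ * t ^ n)) (fun n => ?_) (fun n => ?_) ?_ ?_ ?_
  · convert! h using 1
    funext n
    rw [← integral_sub_rpow_mul_pow hα1 ht n, ← intervalIntegral.integral_const_mul]
    exact intervalIntegral.integral_congr fun τ _ => mul_left_comm _ _ _
  · exact Measurable.aestronglyMeasurable (by fun_prop)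
  · refine Filter.Eventually.of_forall fun τ hτ => ?_
    rw [uIoc_of_le ht.le] at hτ
    rw [norm_mul, norm_mul, Complex.norm_real, norm_pow, Complex.norm_real,
      Real.norm_of_nonneg (Real.rpow_nonneg (by linarith [hτ.2]) _),
      Real.norm_of_nonneg hτ.1.le]
    have := Real.rpow_nonneg (sub_nonneg.2 hτ.2) (-α)
    have := hτ.1.le
    have := hτ.2
    gcongr
  · exact Filter.Eventually.of_forall fun τ _ => hd.mul_left _
  · simp only [tsum_mul_left]
    exact (intervalIntegrable_sub_rpow (by linarith) _ _ _).mul_const _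
  -- The endpoint `τ = t` is discarded: `f` agrees with the series only on `(0, t)`, which says
  -- nothing about its derivative at `t`.
  · filter_upwards [volume.ae_ne t] with τ hτt hτ
    rw [uIoc_of_le ht.le] at hτ
    have hlt : τ < t := lt_of_le_of_ne hτ.2 hτt
    have hτR : |τ| < R := by rw [abs_of_pos hτ.1]; linarith
    have hder : HasDerivAt f (∑' n, derivCoeff c n * (τ : ℂ) ^ n) τ :=
      (hc.hasDerivAt_real hτR).congr_of_eventuallyEq <|
        Filter.eventually_of_mem (Ioo_mem_nhds hτ.1 hlt) hf
    rw [hder.deriv]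
    exact (hc.formalDeriv.summable (by simpa using hτR)).hasSum.mul_left _

/-- On power series, the L-fractional derivative acts as a weighted shift of the coefficients. -/
lemma lDeriv_eq_tsum {T : ℝ} (hT : 0 < T) {α R : ℝ} (hα1 : α < 1) {c : ℕ → ℂ}
    (hc : ConvergesOn R c) {x : Icc (0 : ℝ) T → ℂ}
    (hx : ∀ t : Icc (0 : ℝ) T, (t : ℝ) < R → x t = ∑' n, c n * ((t : ℝ) : ℂ) ^ n)
    (t : Icc (0 : ℝ) T) (ht : (t : ℝ) < R) :
    lDeriv hT α x t = ∑' n, (ratio α (n + 1) : ℂ) * c (n + 1) * ((t : ℝ) : ℂ) ^ n := by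
  have hext : ∀ s ∈ Icc (0 : ℝ) T, s < R → IccExtend hT.le x s = ∑' n, c n * (s : ℂ) ^ n :=
    fun s hs hsR => by rw [IccExtend_of_mem _ _ hs]; exact hx ⟨s, hs⟩ hsR
  rw [lDeriv]
  split_ifs with h0
  -- At `t = 0` both sides reduce to `c 1`, since `ratio α 1 = 1`.
  · rw [h0] at ht ⊢
    have hR := ht
    have hder := hc.hasDerivAt_real (t := 0) (by simpa using hR)
    have h1 : HasDerivWithinAt (IccExtend hT.le x) (∑' n, derivCoeff c n * ((0 : ℝ) : ℂ) ^ n)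
        (Icc 0 T) 0 := by
      refine hder.hasDerivWithinAt.congr_of_eventuallyEq ?_ (hext 0 ⟨le_rfl, hT.le⟩ hR)
      filter_upwards [self_mem_nhdsWithin, mem_nhdsWithin_of_mem_nhds (Iio_mem_nhds hR)]
        with s hs hsR using hext s hs hsR
    rw [h1.derivWithin (uniqueDiffOn_Icc hT 0 ⟨le_rfl, hT.le⟩)]
    rw [tsum_eq_single 0 fun k hk => by simp [hk], tsum_eq_single 0 fun k hk => by simp [hk]]
    simp [derivCoeff, ratio_one hα1]
  · have htpos : 0 < (t : ℝ) := lt_of_le_of_ne t.2.1 (Ne.symm h0)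
    have h := hasSum_caputoDeriv hα1 htpos ht hc (f := IccExtend hT.le x)
      fun s hs => hext s ⟨hs.1.le, hs.2.le.trans t.2.2⟩ (hs.2.trans ht)
    rw [← h.tsum_eq, caputoDeriv_id hα1 htpos, ← tsum_div_const]
    refine tsum_congr fun n => ?_
    have hn : (0 : ℝ) ≤ n := n.cast_nonneg
    -- The quotient of the Caputo derivatives of `t ^ (n + 1)` and of `t`: the powers `t ^ (1 - α)`
    -- cancel and the Beta value supplies the Gamma quotient.
    have hr : (ratio α (n + 1) : ℂ) * ((t : ℝ) : ℂ) ^ n =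
        ((1 / Real.Gamma (1 - α) * ((n : ℝ) + 1) *
          ((t : ℝ) ^ n * (t : ℝ) ^ (1 - α) * ProbabilityTheory.beta (n + 1) (1 - α)) /
            ((t : ℝ) ^ (1 - α) / Real.Gamma (2 - α)) : ℝ) : ℂ) := by
      rw [← Complex.ofReal_pow, ← Complex.ofReal_mul]
      congr 1
      have h1 := (Real.Gamma_pos_of_pos (s := 1 - α) (by linarith)).ne'
      have h2 := (Real.Gamma_pos_of_pos (s := 2 - α) (by linarith)).ne'
      have h3 := (Real.Gamma_pos_of_pos (s := (n : ℝ) + 2 - α) (by linarith)).ne'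
      have h4 := (Real.rpow_pos_of_pos htpos (1 - α)).ne'
      rw [ratio, ProbabilityTheory.beta]
      push_cast
      rw [Real.Gamma_add_one (s := (n : ℝ) + 1) (by positivity),
        show (n : ℝ) + 1 + (1 - α) = n + 2 - α by ring,
        show (n : ℝ) + 1 + 1 - α = n + 2 - α by ring]
      field_simp
    rw [mul_right_comm (ratio α (n + 1) : ℂ), hr, derivCoeff]
    push_cast
    ring

lemma ConvergesOn.ratio_mul {α R : ℝ} (hα0 : 0 < α) (hα1 : α < 1) {c : ℕ → ℂ}
    (hc : ConvergesOn R c) : ConvergesOn R fun n => (ratio α (n + 1) : ℂ) * c (n + 1) :=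
  hc.formalDeriv.mono_norm fun n => by
    rw [norm_mul, derivCoeff, norm_mul, Complex.norm_real,
      Real.norm_of_nonneg (ratio_pos hα1 _).le,
      show (n : ℂ) + 1 = ((n + 1 : ℕ) : ℂ) by push_cast; rfl, Complex.norm_natCast]
    have := ratio_succ_le hα0 hα1 n
    push_cast
    gcongr

lemma ConvergesOn.sum_smul {ι : Type*} [Fintype ι] {R : ℝ} {c : ι → ℕ → ℂ}
    (hc : ∀ i, ConvergesOn R (c i)) (g : ι → ℂ) : ConvergesOn R (∑ i, g i • c i) := by
  intro s hs hsR
  refine Summable.of_nonneg_of_le (fun n => by positivity) (fun n => ?_)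
    (summable_sum (s := Finset.univ) fun i _ => ((hc i) s hs hsR).mul_left ‖g i‖)
  rw [Finset.sum_apply]
  calc ‖∑ i, (g i • c i) n‖ * s ^ n ≤ (∑ i, ‖(g i • c i) n‖) * s ^ n := by
        gcongr; exact norm_sum_le _ _
    _ = _ := by simp [Finset.sum_mul, mul_assoc]

/-- The reason for the normalisation by `weight`: the new factor of `weight α (n + 1)` cancels the
ratio, leaving a pure shift of `b`. -/
lemma shift_div_weight {α : ℝ} (hα1 : α < 1) (b : ℕ → ℂ) (n : ℕ) :
    (ratio α (n + 1) : ℂ) * (b (n + 1) / (weight α (n + 1) : ℂ)) =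
      b (n + 1) / (weight α n : ℂ) := by
  have h1 : (ratio α (n + 1) : ℂ) ≠ 0 := by exact_mod_cast (ratio_pos hα1 _).ne'
  have h2 : (weight α n : ℂ) ≠ 0 := by exact_mod_cast (weight_pos hα1 _).ne'
  rw [weight_succ]
  push_cast
  field_simp

lemma ConvergesOn.shift_div_weight {α R : ℝ} (hα0 : 0 < α) (hα1 : α < 1) {b : ℕ → ℂ}
    (hb : ConvergesOn R fun n => b n / (weight α n : ℂ)) (k : ℕ) :
    ConvergesOn R fun n => b (n + k) / (weight α n : ℂ) := by
  induction k with
  | zero => exact hb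
  | succ k ih =>
    refine (ih.ratio_mul hα0 hα1).mono_norm fun n => le_of_eq ?_
    rw [LFractional.shift_div_weight hα1 (fun n => b (n + k)) n]
    congr 3
    ring

lemma lDeriv_eq_shift {T : ℝ} (hT : 0 < T) {α R : ℝ} (hα1 : α < 1)
    {b : ℕ → ℂ} (hb : ConvergesOn R fun n => b n / (weight α n : ℂ)) {x : Icc (0 : ℝ) T → ℂ}
    (hx : ∀ t : Icc (0 : ℝ) T, (t : ℝ) < R →
      x t = ∑' n, b n / (weight α n : ℂ) * ((t : ℝ) : ℂ) ^ n)
    (t : Icc (0 : ℝ) T) (ht : (t : ℝ) < R) :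
    lDeriv hT α x t = ∑' n, b (n + 1) / (weight α n : ℂ) * ((t : ℝ) : ℂ) ^ n := by
  rw [lDeriv_eq_tsum hT hα1 hb hx t ht]
  simp only [shift_div_weight hα1]

lemma iterate_lDeriv_eq_shift {T : ℝ} (hT : 0 < T) {α R : ℝ} (hα0 : 0 < α) (hα1 : α < 1)
    {b : ℕ → ℂ} (hb : ConvergesOn R fun n => b n / (weight α n : ℂ)) {x : Icc (0 : ℝ) T → ℂ}
    (hx : ∀ t : Icc (0 : ℝ) T, (t : ℝ) < R →
      x t = ∑' n, b n / (weight α n : ℂ) * ((t : ℝ) : ℂ) ^ n) (k : ℕ)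
    (t : Icc (0 : ℝ) T) (ht : (t : ℝ) < R) :
    (lDeriv hT α)^[k] x t = ∑' n, b (n + k) / (weight α n : ℂ) * ((t : ℝ) : ℂ) ^ n := by
  induction k generalizing t with
  | zero => exact hx t ht
  | succ k ih =>
    rw [Function.iterate_succ_apply',
      lDeriv_eq_shift hT hα1 (hb.shift_div_weight hα0 hα1 k) ih t ht]
    refine tsum_congr fun n => ?_
    rw [add_right_comm, add_assoc]

/-- Termwise form of the left-hand side of the equation. -/
lemma hasSum_equation {m : ℕ} (a : Fin m → ℂ) {α R : ℝ} (hα0 : 0 < α) (hα1 : α < 1)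
    {b : ℕ → ℂ} (hb : ConvergesOn R fun n => b n / (weight α n : ℂ)) {t : ℝ} (ht : |t| < R) :
    HasSum (fun n => (b (n + m) + ∑ i : Fin m, a i * b (n + i)) / (weight α n : ℂ) * (t : ℂ) ^ n)
      ((∑' n, b (n + m) / (weight α n : ℂ) * (t : ℂ) ^ n) +
        ∑ i : Fin m, a i * ∑' n, b (n + i) / (weight α n : ℂ) * (t : ℂ) ^ n) := by
  have h : ∀ k, HasSum (fun n => b (n + k) / (weight α n : ℂ) * (t : ℂ) ^ n)
      (∑' n, b (n + k) / (weight α n : ℂ) * (t : ℂ) ^ n) := fun k =>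
    ((hb.shift_div_weight hα0 hα1 k).summable (by simpa using ht)).hasSum
  convert! (h m).add (hasSum_sum (s := Finset.univ) fun (i : Fin m) _ => (h i).mul_left (a i))
    using 1
  funext n
  rw [add_div, add_mul, Finset.sum_div, Finset.sum_mul]
  congr 1
  exact Finset.sum_congr rfl fun i _ => by ring

lemma convergesOn_of_hasSum {T : ℝ} {c : ℕ → ℂ} {x : Icc (0 : ℝ) T → ℂ}
    (hx : ∀ t : Icc (0 : ℝ) T, HasSum (fun n => c n * ((t : ℝ) : ℂ) ^ n) (x t)) :
    ConvergesOn T c := fun s hs hsT =>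
  (hx ⟨s, hs, hsT.le⟩).summable.norm.congr fun n => by simp [abs_of_nonneg hs]

/-! ### The span of the basis functions and the power series solutions -/

section

open Polynomial

variable {α : ℝ} {T : ℝ} {m : ℕ} {a : Fin m → ℂ} {r : ℕ} {μ : Fin r → ℂ} {n : Fin r → ℕ}

/-- A solution of the recurrence is a finite combination of confluent sequences, each of which has
an entire weighted series. -/
lemma convergesOn_of_isSolution (hα0 : 0 < α) (hα1 : α < 1) (hμ : Function.Injective μ)
    (hp : (X ^ m + ∑ i : Fin m, C (a i) * X ^ (i : ℕ) : ℂ[X]) = ∏ l : Fin r, (X - C (μ l)) ^ n l)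
    {b : ℕ → ℂ} (hb : (recurrence a).IsSolution b) (R : ℝ) :
    ConvergesOn R fun n => b n / (weight α n : ℂ) := by
  obtain ⟨g, rfl⟩ := exists_eq_sum_confluentSeq hμ hp hb
  refine (ConvergesOn.sum_smul (fun p : (Σ l : Fin r, Fin (n l)) =>
    convergesOn_confluentSeq hα0 hα1 (μ p.1) p.2 R) g).mono_norm fun N => le_of_eq ?_
  simp [Finset.sum_div, mul_div_assoc]

lemma hasSum_sum_basisFun (hα0 : 0 < α) (hα1 : α < 1)
    (g : (Σ l : Fin r, Fin (n l)) → ℂ) (t : Icc (0 : ℝ) T) :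
    HasSum (fun N => (∑ p, g p • confluentSeq (μ p.1) p.2) N / (weight α N : ℂ) *
      ((t : ℝ) : ℂ) ^ N) ((∑ p, g p • basisFun T α (μ p.1) p.2) t) := by
  rw [Finset.sum_apply]
  convert! hasSum_sum (s := Finset.univ) fun (p : Σ l : Fin r, Fin (n l)) _ =>
    (hasSum_basisFun hα0 hα1 T (μ p.1) p.2 t).mul_left (g p) using 1
  funext N
  simp [Finset.sum_div, Finset.sum_mul, mul_div_assoc, mul_assoc]

lemma mem_span_basisFun_iff (hα0 : 0 < α) (hα1 : α < 1) (hμ : Function.Injective μ)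
    (hp : (X ^ m + ∑ i : Fin m, C (a i) * X ^ (i : ℕ) : ℂ[X]) = ∏ l : Fin r, (X - C (μ l)) ^ n l)
    (x : Icc (0 : ℝ) T → ℂ) :
    x ∈ Submodule.span ℂ (Set.range
      (fun p : (Σ l : Fin r, Fin (n l)) => basisFun T α (μ p.1) p.2)) ↔
    ∃ b, (recurrence a).IsSolution b ∧
      ∀ t : Icc (0 : ℝ) T, HasSum (fun N => b N / (weight α N : ℂ) * ((t : ℝ) : ℂ) ^ N) (x t) := by
  rw [Submodule.mem_span_range_iff_exists_fun]
  constructor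
  · rintro ⟨g, rfl⟩
    refine ⟨∑ p, g p • confluentSeq (μ p.1) p.2, ?_, hasSum_sum_basisFun hα0 hα1 g⟩
    exact Submodule.sum_mem (recurrence a).solSpace fun p _ => Submodule.smul_mem _ _
      (confluentSeq_isSolution hp p.1 p.2.2)
  · rintro ⟨b, hb, hx⟩
    obtain ⟨g, rfl⟩ := exists_eq_sum_confluentSeq hμ hp hb
    exact ⟨g, funext fun t => (hasSum_sum_basisFun hα0 hα1 g t).unique (hx t)⟩

/-- By the identity theorem a relation among the functions holds coefficientwise, and the nonzero
weights divide out, leaving a relation among the confluent sequences. -/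
lemma linearIndependent_basisFun (hα0 : 0 < α) (hα1 : α < 1) (hT : 0 < T)
    (hμ : Function.Injective μ) :
    LinearIndependent ℂ (fun p : (Σ l : Fin r, Fin (n l)) => basisFun T α (μ p.1) p.2) := by
  rw [Fintype.linearIndependent_iff]
  intro g hg
  refine Fintype.linearIndependent_iff.1
    (linearIndependent_confluentSeq (n := n) (m := ∑ l, n l) hμ rfl) g ?_
  have hsum := hasSum_sum_basisFun (T := T) (μ := μ) (n := n) hα0 hα1 g
  funext N
  have h0 := (convergesOn_of_hasSum hsum).eq_zero hT (fun t ht htT => by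
    rw [(hsum ⟨t, ht, htT.le⟩).tsum_eq, hg]; rfl) N
  exact (div_eq_zero_iff.1 h0).resolve_right (by exact_mod_cast (weight_pos hα1 N).ne')

lemma span_eq_analyticSolutions (hα0 : 0 < α) (hα1 : α < 1) (hT : 0 < T)
    (hμ : Function.Injective μ)
    (hp : (X ^ m + ∑ i : Fin m, C (a i) * X ^ (i : ℕ) : ℂ[X]) = ∏ l : Fin r, (X - C (μ l)) ^ n l) :
    (Submodule.span ℂ (Set.range
      (fun p : (Σ l : Fin r, Fin (n l)) => basisFun T α (μ p.1) p.2)) :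
        Set (Icc (0 : ℝ) T → ℂ)) = analyticSolutions hT α a := by
  ext x
  rw [SetLike.mem_coe, mem_span_basisFun_iff hα0 hα1 hμ hp]
  constructor
  · rintro ⟨b, hb, hx⟩
    refine ⟨⟨_, hx⟩, fun t => ?_⟩
    -- A radius beyond `T` puts the endpoint `t = T` inside the open disc, where termwise
    -- differentiation is valid.
    have hconv := convergesOn_of_isSolution hα0 hα1 hμ hp hb (T + 1)
    have ht : (t : ℝ) < T + 1 := by linarith [t.2.2]
    have h := hasSum_equation a hα0 hα1 hconv (t := t) (by rwa [abs_of_nonneg t.2.1])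
    simp only [(recurrence_isSolution_iff a b).1 hb, zero_div, zero_mul] at h
    have hit := fun k => iterate_lDeriv_eq_shift hT hα0 hα1 hconv
      (fun t _ => (hx t).tsum_eq.symm) k t ht
    simp only [hit]
    exact h.unique hasSum_zero
  · rintro ⟨⟨c, hc⟩, hx⟩
    have hw : ∀ N, (weight α N : ℂ) ≠ 0 := fun N => by exact_mod_cast (weight_pos hα1 N).ne'
    obtain ⟨b, rfl⟩ : ∃ b : ℕ → ℂ, c = fun N => b N / (weight α N : ℂ) :=
      ⟨fun N => c N * weight α N, funext fun N => by rw [mul_div_cancel_right₀ _ (hw N)]⟩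
    refine ⟨b, (recurrence_isSolution_iff a b).2 fun N => ?_, hc⟩
    have hconv := convergesOn_of_hasSum hc
    -- Here convergence is known only on the open disc of radius `T`, so the endpoint is left out;
    -- the identity theorem does not need it.
    have hsum : ∀ t : Icc (0 : ℝ) T, (t : ℝ) < T → HasSum (fun N =>
        (b (N + m) + ∑ i : Fin m, a i * b (N + i)) / (weight α N : ℂ) * ((t : ℝ) : ℂ) ^ N) 0 := by
      intro t ht
      have h := hasSum_equation a hα0 hα1 hconv (t := t) (by rwa [abs_of_nonneg t.2.1])
      rw [← hx t]
      have hit := fun k => iterate_lDeriv_eq_shift hT hα0 hα1 hconv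
        (fun t _ => (hc t).tsum_eq.symm) k t ht
      simp only [hit]
      exact h
    have hconv' : ConvergesOn T fun N =>
        (b (N + m) + ∑ i : Fin m, a i * b (N + i)) / (weight α N : ℂ) := fun s hs hsT =>
      (hsum ⟨s, hs, hsT.le⟩ hsT).summable.norm.congr fun n => by simp [abs_of_nonneg hs]
    have h0 := hconv'.eq_zero hT (fun t ht htT => (hsum ⟨t, ht, htT.le⟩ htT).tsum_eq) N
    exact (div_eq_zero_iff.1 h0).resolve_right (hw N)

/-- The iterated L-fractional derivatives of the entire solution with coefficient sequence `b`. -/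
noncomputable def entireChain (T α : ℝ) (b : ℕ → ℂ) (k : ℕ) : Icc (0 : ℝ) T → ℂ :=
  fun t => ∑' N, b (N + k) / (weight α N : ℂ) * ((t : ℝ) : ℂ) ^ N

lemma lDeriv_entireChain (hα0 : 0 < α) (hα1 : α < 1) (hT : 0 < T) {b : ℕ → ℂ}
    (hb : ∀ R, ConvergesOn R fun n => b n / (weight α n : ℂ)) (k : ℕ) :
    lDeriv hT α (entireChain T α b k) = entireChain T α b (k + 1) := by
  funext t
  rw [lDeriv_eq_shift hT hα1 ((hb (T + 1)).shift_div_weight hα0 hα1 k)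
    (x := entireChain T α b k) (fun _ _ => rfl) t
    (by linarith [t.2.2])]
  simp only [entireChain, add_right_comm _ 1 k, add_assoc]

lemma absolutelyContinuousOnInterval_entireChain (hα0 : 0 < α) (hα1 : α < 1) (hT : 0 < T)
    {b : ℕ → ℂ} (hb : ∀ R, ConvergesOn R fun n => b n / (weight α n : ℂ)) (k : ℕ) :
    AbsolutelyContinuousOnInterval (IccExtend hT.le (entireChain T α b k)) 0 T := by
  have hk := fun R => (hb R).shift_div_weight hα0 hα1 k
  have hd := fun t : ℝ => (hk (|t| + 1)).hasDerivAt_real (t := t) (by linarith)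
  have hcont : Continuous fun t : ℝ =>
      ∑' N, derivCoeff (fun N => b (N + k) / (weight α N : ℂ)) N * (t : ℂ) ^ N :=
    continuous_iff_continuousAt.2 fun t =>
      ((hk (|t| + 1)).formalDeriv.hasDerivAt_real (t := t) (by linarith)).continuousAt
  have hC1 : ContDiff ℝ 1 fun t : ℝ => ∑' N, b (N + k) / (weight α N : ℂ) * (t : ℂ) ^ N := by
    refine contDiff_one_iff_deriv.2 ⟨fun t => (hd t).differentiableAt, ?_⟩
    rwa [show deriv (fun t : ℝ => ∑' N, b (N + k) / (weight α N : ℂ) * (t : ℂ) ^ N) = _ from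
      funext fun t => (hd t).deriv]
  refine ContDiffOn.absolutelyContinuousOnInterval (hC1.contDiffOn.congr fun t ht => ?_)
  rw [uIcc_of_le hT.le] at ht
  rw [IccExtend_of_mem _ _ ht, entireChain]

lemma entireChain_equation (hα0 : 0 < α) (hα1 : α < 1) {b : ℕ → ℂ}
    (hb : ∀ R, ConvergesOn R fun n => b n / (weight α n : ℂ))
    (hsol : (recurrence a).IsSolution b) (t : Icc (0 : ℝ) T) :
    entireChain T α b m t + ∑ i : Fin m, a i * entireChain T α b i t = 0 := by
  have h := hasSum_equation a hα0 hα1 (hb (|(t : ℝ)| + 1)) (t := t) (by linarith)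
  simp only [(recurrence_isSolution_iff a b).1 hsol, zero_div, zero_mul] at h
  exact h.unique hasSum_zero

lemma entireChain_zero_apply (hT : 0 < T) (b : ℕ → ℂ) (k : ℕ) :
    entireChain T α b k ⟨0, le_rfl, hT.le⟩ = b k := by
  rw [entireChain, tsum_eq_single 0 fun N hN => by simp [hN]]
  simp [weight_zero]

end

/-! ### The fundamental theorem of calculus for complex absolutely continuous functions -/

section AbsolutelyContinuous

variable {f : ℝ → ℂ} {a b : ℝ}

lemma absolutelyContinuousOnInterval_comp_lipschitz {X Y : Type*} [PseudoMetricSpace X]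
    [PseudoMetricSpace Y] {f : ℝ → X} {g : X → Y} (hg : LipschitzWith 1 g)
    (hf : AbsolutelyContinuousOnInterval f a b) :
    AbsolutelyContinuousOnInterval (fun t => g (f t)) a b := by
  rw [absolutelyContinuousOnInterval_iff] at hf ⊢
  intro ε hε
  obtain ⟨δ, hδ, h⟩ := hf ε hε
  refine ⟨δ, hδ, fun E hE hlen => lt_of_le_of_lt (Finset.sum_le_sum fun i _ => ?_) (h E hE hlen)⟩
  simpa using hg.dist_le_mul (f (E.2 i).1) (f (E.2 i).2)

lemma absolutelyContinuousOnInterval_re (hf : AbsolutelyContinuousOnInterval f a b) :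
    AbsolutelyContinuousOnInterval (fun t => (f t).re) a b :=
  absolutelyContinuousOnInterval_comp_lipschitz
    (LipschitzWith.of_dist_le_mul fun x y => by
      simpa [Real.dist_eq, Complex.dist_eq] using Complex.abs_re_le_norm (x - y)) hf

lemma absolutelyContinuousOnInterval_im (hf : AbsolutelyContinuousOnInterval f a b) :
    AbsolutelyContinuousOnInterval (fun t => (f t).im) a b :=
  absolutelyContinuousOnInterval_comp_lipschitz
    (LipschitzWith.of_dist_le_mul fun x y => by
      simpa [Real.dist_eq, Complex.dist_eq] using Complex.abs_im_le_norm (x - y)) hf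

/-- Reduces integrability and integration of `deriv f` to the real case: almost everywhere both
parts are differentiable, and hence so is `f`. -/
lemma ae_deriv_eq_re_im (hf : AbsolutelyContinuousOnInterval f a b) :
    ∀ᵐ t, t ∈ uIoc a b → ((deriv (fun s => (f s).re) t : ℝ) : ℂ) +
      ((deriv (fun s => (f s).im) t : ℝ) : ℂ) * Complex.I = deriv f t := by
  filter_upwards [(absolutelyContinuousOnInterval_re hf).ae_differentiableAt,
    (absolutelyContinuousOnInterval_im hf).ae_differentiableAt] with t h1 h2 ht
  have ht' := uIoc_subset_uIcc ht
  have h := (h1 ht').hasDerivAt.ofReal_comp.add ((h2 ht').hasDerivAt.ofReal_comp.mul_const Complex.I)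
  rw [← h.deriv]
  congr 1
  funext s
  simp

lemma intervalIntegrable_ofReal {g : ℝ → ℝ} (hg : IntervalIntegrable g volume a b) :
    IntervalIntegrable (fun t => (g t : ℂ)) volume a b :=
  ⟨hg.1.ofReal, hg.2.ofReal⟩

lemma intervalIntegrable_deriv_of_ac (hf : AbsolutelyContinuousOnInterval f a b) :
    IntervalIntegrable (deriv f) volume a b := by
  refine IntervalIntegrable.congr_ae ?_
    ((ae_restrict_iff' measurableSet_uIoc).2 (ae_deriv_eq_re_im hf))
  exact (intervalIntegrable_ofReal
      (absolutelyContinuousOnInterval_re hf).intervalIntegrable_deriv).add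
    ((intervalIntegrable_ofReal
      (absolutelyContinuousOnInterval_im hf).intervalIntegrable_deriv).mul_const _)

lemma integral_deriv_eq_sub_of_ac (hf : AbsolutelyContinuousOnInterval f a b) :
    ∫ t in a..b, deriv f t = f b - f a := by
  rw [← intervalIntegral.integral_congr_ae (ae_deriv_eq_re_im hf),
    intervalIntegral.integral_add
      (intervalIntegrable_ofReal (absolutelyContinuousOnInterval_re hf).intervalIntegrable_deriv)
      ((intervalIntegrable_ofReal
        (absolutelyContinuousOnInterval_im hf).intervalIntegrable_deriv).mul_const _),
    intervalIntegral.integral_mul_const, intervalIntegral.integral_ofReal,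
    intervalIntegral.integral_ofReal,
    (absolutelyContinuousOnInterval_re hf).integral_deriv_eq_sub,
    (absolutelyContinuousOnInterval_im hf).integral_deriv_eq_sub]
  apply Complex.ext <;> simp

end AbsolutelyContinuous

/-! ### Abel's integral equation -/

section Abel

/-- The Beta integral on `[τ, t]`. -/
lemma integral_abel_kernel {α τ t : ℝ} (hα0 : 0 < α) (hα1 : α < 1) (h : τ < t) :
    ∫ s in τ..t, (t - s) ^ (α - 1) * (s - τ) ^ (-α) = Real.Gamma α * Real.Gamma (1 - α) := by
  have h1 := integral_rpow_mul_rpow (a := 1 - α) (b := α) (by linarith) hα0 (sub_pos.2 h)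
  have h2 := intervalIntegral.integral_comp_sub_right
    (fun s => s ^ (1 - α - 1) * (t - τ - s) ^ (α - 1)) τ (a := τ) (b := t)
  rw [sub_self, h1, sub_add_cancel, sub_self, Real.rpow_zero, one_mul, ProbabilityTheory.beta,
    sub_add_cancel, Real.Gamma_one, div_one, mul_comm (Real.Gamma _)] at h2
  rw [← h2]
  refine intervalIntegral.integral_congr fun s _ => ?_
  simp only [sub_sub_sub_cancel_right]
  rw [mul_comm, show 1 - α - 1 = -α by ring]

/-- The kernel of the composition of two Abel integrals, with its support condition. -/
noncomputable def abelKernel (α t s τ : ℝ) : ℝ :=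
  if τ < s then (t - s) ^ (α - 1) * (s - τ) ^ (-α) else 0

lemma measurable_abelKernel (α t : ℝ) :
    Measurable fun p : ℝ × ℝ => abelKernel α t p.1 p.2 :=
  Measurable.ite (measurableSet_lt measurable_snd measurable_fst) (by fun_prop) measurable_const

lemma abelKernel_nonneg {α t s : ℝ} (hs : s ≤ t) (τ : ℝ) : 0 ≤ abelKernel α t s τ := by
  rw [abelKernel]
  split_ifs with h
  · exact mul_nonneg (Real.rpow_nonneg (by linarith) _) (Real.rpow_nonneg (by linarith) _)
  · exact le_rfl

lemma integral_abelKernel {α t τ : ℝ} (hα0 : 0 < α) (hα1 : α < 1) (hτ : τ ∈ Ioo 0 t) :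
    ∫ s in Ioc 0 t, abelKernel α t s τ = Real.Gamma α * Real.Gamma (1 - α) := by
  rw [← integral_abel_kernel hα0 hα1 hτ.2, intervalIntegral.integral_of_le hτ.2.le,
    show (fun s => abelKernel α t s τ) =
      (Ioi τ).indicator fun s => (t - s) ^ (α - 1) * (s - τ) ^ (-α) by
        funext s; simp [abelKernel, indicator],
    setIntegral_indicator measurableSet_Ioi]
  congr 2
  ext s
  simp only [mem_inter_iff, mem_Ioc, mem_Ioi]
  constructor
  · rintro ⟨⟨_, h⟩, h'⟩; exact ⟨h', h⟩
  · rintro ⟨h, h'⟩; exact ⟨⟨hτ.1.trans h, h'⟩, h⟩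

lemma gamma_mul_gamma_pos {α : ℝ} (hα0 : 0 < α) (hα1 : α < 1) :
    0 < Real.Gamma α * Real.Gamma (1 - α) :=
  mul_pos (Real.Gamma_pos_of_pos hα0) (Real.Gamma_pos_of_pos (by linarith))

/-- The Bochner integral of a non-integrable function is `0`, whereas this integral was computed to
be positive. -/
lemma integrable_abelKernel {α t τ : ℝ} (hα0 : 0 < α) (hα1 : α < 1) (hτ : τ ∈ Ioo 0 t) :
    Integrable (fun s => abelKernel α t s τ) (volume.restrict (Ioc 0 t)) := by
  by_contra h
  have := integral_abelKernel hα0 hα1 hτ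
  rw [integral_undef h] at this
  exact (gamma_mul_gamma_pos hα0 hα1).ne this

lemma ae_mem_Ioo (t : ℝ) : ∀ᵐ τ ∂(volume.restrict (Ioc 0 t)), τ ∈ Ioo 0 t := by
  rw [← restrict_Ioo_eq_restrict_Ioc]
  exact ae_restrict_mem measurableSet_Ioo

/-- Abel's inversion formula: the fractional integrals of orders `1 - α` and `α` compose to the
ordinary integral. -/
lemma abel_inversion {α t : ℝ} (hα0 : 0 < α) (hα1 : α < 1) (ht : 0 ≤ t) {g : ℝ → ℂ}
    (hg : IntervalIntegrable g volume 0 t) :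
    ∫ s in (0 : ℝ)..t, (((t - s) ^ (α - 1) : ℝ) : ℂ) *
        ∫ τ in (0 : ℝ)..s, (((s - τ) ^ (-α) : ℝ) : ℂ) * g τ =
      ((Real.Gamma α * Real.Gamma (1 - α) : ℝ) : ℂ) * ∫ τ in (0 : ℝ)..t, g τ := by
  have hg' : Integrable g (volume.restrict (Ioc 0 t)) :=
    (intervalIntegrable_iff_integrableOn_Ioc_of_le ht).1 hg
  -- Fubini's hypothesis: integrating the nonnegative kernel over `s` first gives a constant
  -- independent of `τ`, so the norm integral is that constant times the integral of `‖g‖`.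
  have hint : Integrable (Function.uncurry fun s τ => (abelKernel α t s τ : ℂ) * g τ)
      ((volume.restrict (Ioc 0 t)).prod (volume.restrict (Ioc 0 t))) := by
    have hmeas : AEStronglyMeasurable
        (Function.uncurry fun s τ => (abelKernel α t s τ : ℂ) * g τ)
        ((volume.restrict (Ioc 0 t)).prod (volume.restrict (Ioc 0 t))) :=
      AEStronglyMeasurable.mul (f := fun p : ℝ × ℝ => (abelKernel α t p.1 p.2 : ℂ))
        (g := fun p : ℝ × ℝ => g p.2)
        (Complex.measurable_ofReal.comp (measurable_abelKernel α t)).aestronglyMeasurable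
        hg'.aestronglyMeasurable.comp_snd
    rw [integrable_prod_iff' hmeas]
    constructor
    · filter_upwards [ae_mem_Ioo t] with τ hτ
      exact ((integrable_abelKernel hα0 hα1 hτ).ofReal (𝕜 := ℂ)).mul_const (g τ)
    · refine (hg'.norm.const_mul (Real.Gamma α * Real.Gamma (1 - α))).congr ?_
      filter_upwards [ae_mem_Ioo t] with τ hτ
      rw [← integral_abelKernel hα0 hα1 hτ, ← integral_mul_const]
      refine setIntegral_congr_fun measurableSet_Ioc fun s hs => ?_
      simp only [Function.uncurry, norm_mul, Complex.norm_real,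
        Real.norm_of_nonneg (abelKernel_nonneg hs.2 τ)]
  calc _ = ∫ s in Ioc 0 t, ∫ τ in Ioc 0 t, (abelKernel α t s τ : ℂ) * g τ := by
        rw [intervalIntegral.integral_of_le ht]
        refine setIntegral_congr_fun measurableSet_Ioc fun s hs => ?_
        rw [intervalIntegral.integral_of_le hs.1.le, ← integral_const_mul,
          show (fun τ => (abelKernel α t s τ : ℂ) * g τ) = (Iio s).indicator fun τ =>
            (((t - s) ^ (α - 1) : ℝ) : ℂ) * ((((s - τ) ^ (-α) : ℝ) : ℂ) * g τ) by
              funext τ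
              simp only [abelKernel, indicator, mem_Iio]
              split_ifs <;> simp [mul_assoc],
          setIntegral_indicator measurableSet_Iio,
          show Ioc 0 t ∩ Iio s = Ioo 0 s by
            ext τ
            simp only [mem_inter_iff, mem_Ioc, mem_Iio, mem_Ioo]
            exact ⟨fun h => ⟨h.1.1, h.2⟩, fun h => ⟨⟨h.1, h.2.le.trans hs.2⟩, h.2⟩⟩,
          restrict_Ioo_eq_restrict_Ioc]
    _ = ∫ τ in Ioc 0 t, ∫ s in Ioc 0 t, (abelKernel α t s τ : ℂ) * g τ :=
        integral_integral_swap hint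
    _ = ∫ τ in Ioc 0 t, ((Real.Gamma α * Real.Gamma (1 - α) : ℝ) : ℂ) * g τ := by
        refine integral_congr_ae ?_
        filter_upwards [ae_mem_Ioo t] with τ hτ
        rw [integral_mul_const, integral_complex_ofReal, integral_abelKernel hα0 hα1 hτ]
    _ = _ := by rw [integral_const_mul, intervalIntegral.integral_of_le ht]

end Abel

/-! ### Uniqueness through a weakly singular Volterra equation -/

/-- An absolutely continuous function is recovered from its L-fractional derivative. -/
lemma sub_eq_integral_of_lDeriv {α T : ℝ} (hα0 : 0 < α) (hα1 : α < 1) (hT : 0 < T)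
    {y : Icc (0 : ℝ) T → ℂ} (hy : AbsolutelyContinuousOnInterval (IccExtend hT.le y) 0 T)
    {V : ℝ → ℂ}
    (hV : ∀ᵐ t ∂(volume.comap (Subtype.val : Icc (0 : ℝ) T → ℝ)), lDeriv hT α y t = V t)
    {t : ℝ} (ht : t ∈ Icc 0 T) :
    IccExtend hT.le y t - IccExtend hT.le y 0 =
      ((1 / (Real.Gamma α * Real.Gamma (2 - α)) : ℝ) : ℂ) *
        ∫ s in (0 : ℝ)..t, (((t - s) ^ (α - 1) : ℝ) : ℂ) * (((s ^ (1 - α) : ℝ) : ℂ) * V s) := by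
  have hyt : AbsolutelyContinuousOnInterval (IccExtend hT.le y) 0 t :=
    hy.mono (by rw [uIcc_of_le ht.1, uIcc_of_le hT.le]; exact Icc_subset_Icc_right ht.2)
  have hinv := abel_inversion hα0 hα1 ht.1 (intervalIntegrable_deriv_of_ac hyt)
  rw [integral_deriv_eq_sub_of_ac hyt] at hinv
  have hG1 := (Real.Gamma_pos_of_pos (s := 1 - α) (by linarith)).ne'
  have hG2 := (Real.Gamma_pos_of_pos (s := 2 - α) (by linarith)).ne'
  have hG := (Real.Gamma_pos_of_pos hα0).ne'
  have hV' : ∀ᵐ s, s ∈ Icc 0 T → ∀ hs : s ∈ Icc 0 T, lDeriv hT α y ⟨s, hs⟩ = V s := by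
    have h := (ae_restrict_iff_subtype (μ := volume) (s := Icc (0 : ℝ) T) measurableSet_Icc
      (p := fun s => ∀ hs : s ∈ Icc 0 T, lDeriv hT α y ⟨s, hs⟩ = V s)).2
        (hV.mono fun s hs _ => hs)
    exact (ae_restrict_iff' measurableSet_Icc).1 h
  -- The inner integral is `Γ(1 - α)` times the Caputo derivative of `y`, which is `V s` times `s ^
  -- (1 - α) / Γ(2 - α)`, the Caputo derivative of the identity.
  have hcongr : ∫ s in (0 : ℝ)..t, (((t - s) ^ (α - 1) : ℝ) : ℂ) *
        ∫ τ in (0 : ℝ)..s, (((s - τ) ^ (-α) : ℝ) : ℂ) * deriv (IccExtend hT.le y) τ =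
      ∫ s in (0 : ℝ)..t, ((Real.Gamma (1 - α) / Real.Gamma (2 - α) : ℝ) : ℂ) *
        ((((t - s) ^ (α - 1) : ℝ) : ℂ) * (((s ^ (1 - α) : ℝ) : ℂ) * V s)) := by
    refine intervalIntegral.integral_congr_ae ?_
    filter_upwards [hV'] with s hs hst
    rw [uIoc_of_le ht.1] at hst
    have hsT : s ∈ Icc 0 T := ⟨hst.1.le, hst.2.trans ht.2⟩
    have h := hs hsT hsT
    have hpow := (Real.rpow_pos_of_pos hst.1 (1 - α)).ne'
    rw [lDeriv, if_neg hst.1.ne', caputoDeriv_id hα1 hst.1, caputoDeriv] at h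
    rw [← h]
    push_cast
    have e1 : (Real.Gamma (1 - α) : ℂ) ≠ 0 := by exact_mod_cast hG1
    have e2 : (Real.Gamma (2 - α) : ℂ) ≠ 0 := by exact_mod_cast hG2
    have e3 : ((s ^ (1 - α) : ℝ) : ℂ) ≠ 0 := by exact_mod_cast hpow
    field_simp
  rw [hcongr, intervalIntegral.integral_const_mul] at hinv
  have e : ((Real.Gamma α * Real.Gamma (1 - α) : ℝ) : ℂ) ≠ 0 := by
    exact_mod_cast (gamma_mul_gamma_pos hα0 hα1).ne'
  apply mul_left_cancel₀ e
  rw [← hinv, ← mul_assoc, ← Complex.ofReal_mul]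
  congr 2
  field_simp

/-- A Gronwall inequality for the Abel kernel `(t - s) ^ (α - 1)`. -/
lemma abel_gronwall {α T K : ℝ} (hα0 : 0 < α) (hT : 0 ≤ T) (hK : 0 ≤ K) {U : ℝ → ℝ}
    (hU : ContinuousOn U (Icc 0 T)) (hU0 : ∀ t ∈ Icc 0 T, 0 ≤ U t)
    (h : ∀ t ∈ Icc 0 T, U t ≤ K * ∫ s in (0 : ℝ)..t, (t - s) ^ (α - 1) * U s)
    {t : ℝ} (ht : t ∈ Icc 0 T) : U t = 0 := by
  have hG := Real.Gamma_pos_of_pos hα0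
  -- The rate `l` of an exponentially weighted sup norm: `(1 / l) ^ α * Γ(α)` is the integral of `r
  -- ^ (α - 1) * exp (-l r)` over `(0, ∞)`, and it tends to `0` as `l` grows.
  obtain ⟨l, hl, hKl⟩ : ∃ l : ℝ, 0 < l ∧ K * ((1 / l) ^ α * Real.Gamma α) < 1 := by
    have hlim : Filter.Tendsto (fun l : ℝ => K * ((1 / l) ^ α * Real.Gamma α)) Filter.atTop
        (nhds (K * (0 * Real.Gamma α))) := by
      refine ((Filter.Tendsto.mul_const _ ?_).const_mul _)
      have h1 := (tendsto_inv_atTop_zero (𝕜 := ℝ)).rpow_const (p := α) (Or.inr hα0.le)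
      simpa [Real.zero_rpow hα0.ne'] using h1
    rw [zero_mul, mul_zero] at hlim
    exact ((Filter.eventually_gt_atTop 0).and (hlim.eventually_lt_const one_pos)).exists
  have hval := Real.integral_rpow_mul_exp_neg_mul_Ioi hα0 hl
  have hint : IntegrableOn (fun r : ℝ => r ^ (α - 1) * Real.exp (-(l * r))) (Ioi 0) := by
    by_contra hcon
    rw [integral_undef hcon] at hval
    have : 0 < (1 / l) ^ α * Real.Gamma α := by positivity
    exact this.ne hval
  obtain ⟨p, hp, hmax⟩ := isCompact_Icc.exists_isMaxOn (nonempty_Icc.2 hT)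
    (ContinuousOn.mul (f := fun s : ℝ => Real.exp (-(l * s))) (by fun_prop) hU)
  have hmax' : ∀ s ∈ Icc 0 T, U s ≤ Real.exp (l * s) * (Real.exp (-(l * p)) * U p) := by
    intro s hs
    have h1 : Real.exp (-(l * s)) * U s ≤ Real.exp (-(l * p)) * U p := hmax hs
    calc U s = Real.exp (l * s) * (Real.exp (-(l * s)) * U s) := by
          rw [← mul_assoc, ← Real.exp_add, add_neg_cancel, Real.exp_zero, one_mul]
      _ ≤ _ := by gcongr
  have hpp : Icc (0 : ℝ) p ⊆ Icc 0 T := Icc_subset_Icc_right hp.2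
  have hU0p := hU0 p hp
  -- At the maximum `p` of `exp (-l s) * U s` one has `U s ≤ exp (-l (p - s)) * U p`. The integral
  -- inequality at `p` then bounds `U p` by a factor below `1` times itself.
  have hle : U p ≤ (K * ((1 / l) ^ α * Real.Gamma α)) * U p := by
    calc U p ≤ K * ∫ s in (0 : ℝ)..p, (p - s) ^ (α - 1) * U s := h p hp
      _ ≤ K * ∫ s in (0 : ℝ)..p, (p - s) ^ (α - 1) * Real.exp (-(l * (p - s))) * U p := by
        refine mul_le_mul_of_nonneg_left ?_ hK
        refine intervalIntegral.integral_mono_on hp.1 ?_ ?_ fun s hs => ?_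
        · exact (intervalIntegrable_sub_rpow (by linarith) _ _ _).mul_continuousOn
            (hU.mono (by rwa [uIcc_of_le hp.1]))
        · refine (IntervalIntegrable.mul_continuousOn
            (intervalIntegrable_sub_rpow (by linarith) _ _ _) ?_).mul_const _
          fun_prop
        · rw [mul_assoc]
          refine mul_le_mul_of_nonneg_left ?_ (Real.rpow_nonneg (by linarith [hs.2]) _)
          refine (hmax' s (hpp hs)).trans (le_of_eq ?_)
          rw [← mul_assoc, ← Real.exp_add]
          congr 2
          ring
      _ = K * ((∫ r in (0 : ℝ)..p, r ^ (α - 1) * Real.exp (-(l * r))) * U p) := by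
        rw [intervalIntegral.integral_mul_const]
        have := intervalIntegral.integral_comp_sub_left
          (fun r : ℝ => r ^ (α - 1) * Real.exp (-(l * r))) p (a := 0) (b := p)
        rw [this, sub_self, sub_zero]
      _ ≤ K * (((1 / l) ^ α * Real.Gamma α) * U p) := by
        rw [← hval, intervalIntegral.integral_of_le hp.1]
        refine mul_le_mul_of_nonneg_left (mul_le_mul_of_nonneg_right ?_ hU0p) hK
        refine setIntegral_mono_set hint ?_ Ioc_subset_Ioi_self.eventuallyLE
        filter_upwards [ae_restrict_mem measurableSet_Ioi] with r hr
        have hr0 : (0 : ℝ) ≤ r := le_of_lt hr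
        exact mul_nonneg (Real.rpow_nonneg hr0 _) (Real.exp_pos _).le
      _ = _ := by ring
  have hp0 : U p = 0 := by nlinarith
  have := hmax' t ht
  rw [hp0, mul_zero, mul_zero] at this
  exact le_antisymm this (hU0 t ht)

/-- Comparison of two fractional integrals. -/
lemma norm_integral_sub_le {α T A : ℝ} (hα0 : 0 < α) (hα1 : α < 1) {V W : ℝ → ℂ}
    {U : ℝ → ℝ} (hV : ContinuousOn V (Icc 0 T)) (hW : ContinuousOn W (Icc 0 T))
    (hU : ContinuousOn U (Icc 0 T)) (hVW : ∀ s ∈ Icc 0 T, ‖V s - W s‖ ≤ A * U s)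
    {t : ℝ} (ht : t ∈ Icc 0 T) :
    ‖(∫ s in (0 : ℝ)..t, (((t - s) ^ (α - 1) : ℝ) : ℂ) * (((s ^ (1 - α) : ℝ) : ℂ) * V s)) -
      ∫ s in (0 : ℝ)..t, (((t - s) ^ (α - 1) : ℝ) : ℂ) * (((s ^ (1 - α) : ℝ) : ℂ) * W s)‖ ≤
      T ^ (1 - α) * A * ∫ s in (0 : ℝ)..t, (t - s) ^ (α - 1) * U s := by
  have hsub : uIcc 0 t ⊆ Icc 0 T := by rw [uIcc_of_le ht.1]; exact Icc_subset_Icc_right ht.2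
  have hker := intervalIntegrable_sub_rpow (b := α - 1) (by linarith) t 0 t
  have hpow : ContinuousOn (fun s : ℝ => ((s ^ (1 - α) : ℝ) : ℂ)) (uIcc 0 t) :=
    (Complex.continuous_ofReal.comp
      (Real.continuous_rpow_const (by linarith : (0 : ℝ) ≤ 1 - α))).continuousOn
  have hI : ∀ Z : ℝ → ℂ, ContinuousOn Z (Icc 0 T) → IntervalIntegrable (fun s : ℝ =>
      (((t - s) ^ (α - 1) : ℝ) : ℂ) * (((s ^ (1 - α) : ℝ) : ℂ) * Z s)) volume 0 t :=
    fun Z hZ => (intervalIntegrable_ofReal hker).mul_continuousOn (hpow.mul (hZ.mono hsub))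
  rw [← intervalIntegral.integral_sub (hI V hV) (hI W hW), ← intervalIntegral.integral_const_mul]
  refine intervalIntegral.norm_integral_le_of_norm_le ht.1 ?_
    ((hker.mul_continuousOn (hU.mono hsub)).const_mul _)
  refine Filter.Eventually.of_forall fun s hs => ?_
  have hsT : s ∈ Icc 0 T := ⟨hs.1.le, hs.2.trans ht.2⟩
  have h1 := Real.rpow_nonneg (sub_nonneg.2 hs.2) (α - 1)
  have h2 := Real.rpow_nonneg hs.1.le (1 - α)
  have h3 : s ^ (1 - α) ≤ T ^ (1 - α) := Real.rpow_le_rpow hs.1.le hsT.2 (by linarith)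
  rw [← mul_sub, ← mul_sub, norm_mul, norm_mul, Complex.norm_real, Complex.norm_real,
    Real.norm_of_nonneg h1, Real.norm_of_nonneg h2]
  calc (t - s) ^ (α - 1) * (s ^ (1 - α) * ‖V s - W s‖)
      ≤ (t - s) ^ (α - 1) * (T ^ (1 - α) * (A * U s)) := by
        have := hVW s hsT
        have := h2.trans h3
        gcongr
    _ = _ := by ring

/-- Two chains of absolutely continuous functions that solve the equation and have the same
initial values coincide. -/
lemma chain_unique {α T : ℝ} (hα0 : 0 < α) (hα1 : α < 1) (hT : 0 < T) {m : ℕ}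
    (a : Fin m → ℂ) {y z : ℕ → Icc (0 : ℝ) T → ℂ}
    (hy : ∀ k < m, AbsolutelyContinuousOnInterval (IccExtend hT.le (y k)) 0 T)
    (hz : ∀ k < m, AbsolutelyContinuousOnInterval (IccExtend hT.le (z k)) 0 T)
    (hdy : ∀ k < m, ∀ᵐ t ∂(volume.comap (Subtype.val : Icc (0 : ℝ) T → ℝ)),
      lDeriv hT α (y k) t = y (k + 1) t)
    (hdz : ∀ k < m, ∀ᵐ t ∂(volume.comap (Subtype.val : Icc (0 : ℝ) T → ℝ)),
      lDeriv hT α (z k) t = z (k + 1) t)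
    (hey : ∀ᵐ t ∂(volume.comap (Subtype.val : Icc (0 : ℝ) T → ℝ)),
      y m t + ∑ i : Fin m, a i * y i t = 0)
    (hez : ∀ᵐ t ∂(volume.comap (Subtype.val : Icc (0 : ℝ) T → ℝ)),
      z m t + ∑ i : Fin m, a i * z i t = 0)
    (h0 : ∀ k < m, y k ⟨0, le_rfl, hT.le⟩ = z k ⟨0, le_rfl, hT.le⟩) {k : ℕ} (hk : k < m) :
    y k = z k := by
  -- The top function `y m` is constrained only almost everywhere, so the equation is used to
  -- replace it by the continuous `-∑ a i * y i`.
  let E : (ℕ → Icc (0 : ℝ) T → ℂ) → ℕ → ℝ → ℂ := fun y k s =>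
    if k < m then IccExtend hT.le (y k) s else -∑ i : Fin m, a i * IccExtend hT.le (y i) s
  have hE : ∀ y : ℕ → Icc (0 : ℝ) T → ℂ,
      (∀ k < m, AbsolutelyContinuousOnInterval (IccExtend hT.le (y k)) 0 T) →
      ∀ k, ContinuousOn (E y k) (Icc 0 T) := by
    intro y hy k
    have hc : ∀ k < m, ContinuousOn (IccExtend hT.le (y k)) (Icc 0 T) := fun k hk => by
      simpa [uIcc_of_le hT.le] using (hy k hk).continuousOn
    by_cases hk : k < m
    · simpa [E, hk] using hc k hk
    · simp only [E, hk, if_false]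
      exact (continuousOn_finsetSum _ fun (i : Fin m) _ => continuousOn_const.mul (hc i i.2)).neg
  have hEd : ∀ y : ℕ → Icc (0 : ℝ) T → ℂ,
      (∀ k < m, ∀ᵐ t ∂(volume.comap (Subtype.val : Icc (0 : ℝ) T → ℝ)),
        lDeriv hT α (y k) t = y (k + 1) t) →
      (∀ᵐ t ∂(volume.comap (Subtype.val : Icc (0 : ℝ) T → ℝ)),
        y m t + ∑ i : Fin m, a i * y i t = 0) → ∀ k < m,
      ∀ᵐ t ∂(volume.comap (Subtype.val : Icc (0 : ℝ) T → ℝ)),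
        lDeriv hT α (y k) t = E y (k + 1) t := by
    intro y hd he k hk
    filter_upwards [hd k hk, he] with t h1 h2
    rw [h1]
    by_cases hk' : k + 1 < m
    · simp [E, hk']
    · obtain rfl : k + 1 = m := by omega
      simp only [E, lt_irrefl, if_false, IccExtend_val]
      exact eq_neg_of_add_eq_zero_left h2
  let U : ℝ → ℝ := fun s => ∑ k : Fin m, ‖E y k s - E z k s‖
  -- The summand `1` serves the indices below `m`, the sum of the `‖a i‖` the replaced top function.
  let A : ℝ := 1 + ∑ i, ‖a i‖
  have hU0 : ∀ s, 0 ≤ U s := fun s => Finset.sum_nonneg fun _ _ => norm_nonneg _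
  have hUc : ContinuousOn U (Icc 0 T) :=
    continuousOn_finsetSum _ fun k _ => ((hE y hy k).sub (hE z hz k)).norm
  have hle : ∀ (k : Fin m) s, ‖E y k s - E z k s‖ ≤ U s := fun k s =>
    Finset.single_le_sum (f := fun k : Fin m => ‖E y k s - E z k s‖)
      (fun _ _ => norm_nonneg _) (Finset.mem_univ k)
  have hA : ∀ k s, ‖E y k s - E z k s‖ ≤ A * U s := by
    intro k s
    by_cases hk : k < m
    · have h1 : 0 ≤ (∑ i, ‖a i‖) * U s :=
        mul_nonneg (Finset.sum_nonneg fun _ _ => norm_nonneg _) (hU0 s)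
      calc _ ≤ U s := hle ⟨k, hk⟩ s
        _ ≤ A * U s := by simp only [A, add_mul, one_mul]; linarith
    · have h1 : E y k s - E z k s = -∑ i : Fin m, a i * (E y i s - E z i s) := by
        simp only [E, hk, if_false, Fin.is_lt, if_true, mul_sub, Finset.sum_sub_distrib]
        ring
      rw [h1, norm_neg]
      calc _ ≤ ∑ i : Fin m, ‖a i * (E y i s - E z i s)‖ := norm_sum_le _ _
        _ ≤ ∑ i : Fin m, ‖a i‖ * U s := Finset.sum_le_sum fun i _ => by
          rw [norm_mul]
          exact mul_le_mul_of_nonneg_left (hle i s) (norm_nonneg _)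
        _ ≤ A * U s := by
          rw [← Finset.sum_mul]
          have := hU0 s
          gcongr
          simp [A]
  let c : ℝ := 1 / (Real.Gamma α * Real.Gamma (2 - α))
  have hc : 0 ≤ c := one_div_nonneg.2 (mul_nonneg (Real.Gamma_pos_of_pos hα0).le
    (Real.Gamma_pos_of_pos (by linarith)).le)
  have hA0 : 0 ≤ A := add_nonneg zero_le_one (Finset.sum_nonneg fun _ _ => norm_nonneg _)
  have hTp : 0 ≤ T ^ (1 - α) := Real.rpow_nonneg hT.le _
  -- Each of the `m` components satisfies the same Volterra estimate, because the initial values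
  -- cancel; this is where the factor `m` comes from.
  have hbound : ∀ t ∈ Icc 0 T, U t ≤ (m * (c * (T ^ (1 - α) * A))) *
      ∫ s in (0 : ℝ)..t, (t - s) ^ (α - 1) * U s := by
    intro t ht
    calc U t ≤ ∑ _k : Fin m, c * (T ^ (1 - α) * A * ∫ s in (0 : ℝ)..t, (t - s) ^ (α - 1) * U s) := by
          refine Finset.sum_le_sum fun k _ => ?_
          have h1 := sub_eq_integral_of_lDeriv hα0 hα1 hT (hy k k.2) (hEd y hdy hey k k.2) ht
          have h2 := sub_eq_integral_of_lDeriv hα0 hα1 hT (hz k k.2) (hEd z hdz hez k k.2) ht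
          have h00 : IccExtend hT.le (y k) 0 = IccExtend hT.le (z k) 0 := by
            rw [IccExtend_of_mem _ _ ⟨le_rfl, hT.le⟩, IccExtend_of_mem _ _ ⟨le_rfl, hT.le⟩]
            exact h0 k k.2
          have h3 : E y k t - E z k t =
              (IccExtend hT.le (y k) t - IccExtend hT.le (y k) 0) -
                (IccExtend hT.le (z k) t - IccExtend hT.le (z k) 0) := by
            simp only [E, Fin.is_lt, if_true, h00]
            ring
          rw [h3, h1, h2, ← mul_sub, norm_mul, Complex.norm_real, Real.norm_of_nonneg hc]
          exact mul_le_mul_of_nonneg_left (norm_integral_sub_le hα0 hα1 (hE y hy _) (hE z hz _) hUc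
            (fun s _ => hA _ s) ht) hc
      _ = _ := by
          rw [Finset.sum_const, Finset.card_univ, Fintype.card_fin, nsmul_eq_mul]
          ring
  funext t
  have hUt := abel_gronwall hα0 hT.le (by positivity) hUc (fun s _ => hU0 s) hbound t.2
  have := (hle ⟨k, hk⟩ t).trans_eq hUt
  have h1 := sub_eq_zero.1 (norm_le_zero_iff.1 this)
  simpa [E, hk] using h1

/-! ### The absolutely continuous solutions -/

section

open Polynomial

variable {α : ℝ} {T : ℝ} {m : ℕ} {a : Fin m → ℂ} {r : ℕ} {μ : Fin r → ℂ} {n : Fin r → ℕ}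

lemma span_eq_solutions (hα0 : 0 < α) (hα1 : α < 1) (hT : 0 < T) (hm : 1 ≤ m)
    (hμ : Function.Injective μ)
    (hp : (X ^ m + ∑ i : Fin m, C (a i) * X ^ (i : ℕ) : ℂ[X]) = ∏ l : Fin r, (X - C (μ l)) ^ n l) :
    (Submodule.span ℂ (Set.range
      (fun p : (Σ l : Fin r, Fin (n l)) => basisFun T α (μ p.1) p.2)) :
        Set (Icc (0 : ℝ) T → ℂ)) = solutions hT α a := by
  ext x
  rw [SetLike.mem_coe, mem_span_basisFun_iff hα0 hα1 hμ hp]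
  constructor
  · rintro ⟨b, hb, hx⟩
    have hconv := convergesOn_of_isSolution hα0 hα1 hμ hp hb
    exact ⟨entireChain T α b, funext fun t => (hx t).tsum_eq,
      fun k _ => absolutelyContinuousOnInterval_entireChain hα0 hα1 hT hconv k,
      fun k _ => Filter.Eventually.of_forall fun t => by
        rw [lDeriv_entireChain hα0 hα1 hT hconv k],
      Filter.Eventually.of_forall fun t => entireChain_equation hα0 hα1 hconv hb t⟩
  · rintro ⟨y, rfl, hac, hd, he⟩
    -- The `k`-th iterate of the entire solution takes the value `b k` at `0`, so the solution of
    -- the recurrence is started from the values `y k 0`.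
    let init : Fin (recurrence a).order → ℂ := fun k => y k ⟨0, le_rfl, hT.le⟩
    let b := (recurrence a).mkSol init
    have hb : (recurrence a).IsSolution b := (recurrence a).is_sol_mkSol init
    have hconv := convergesOn_of_isSolution hα0 hα1 hμ hp hb
    -- Uniqueness is needed only at index `0`, which lies below `m` because `1 ≤ m`.
    have hyz := chain_unique hα0 hα1 hT a hac
      (fun k _ => absolutelyContinuousOnInterval_entireChain hα0 hα1 hT hconv k) hd
      (fun k _ => Filter.Eventually.of_forall fun t => by
        rw [lDeriv_entireChain hα0 hα1 hT hconv k]) he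
      (Filter.Eventually.of_forall fun t => entireChain_equation hα0 hα1 hconv hb t)
      (fun k hk => by
        rw [entireChain_zero_apply hT]
        exact ((recurrence a).mkSol_eq_init init ⟨k, hk⟩).symm) (k := 0) (by omega)
    refine ⟨b, hb, fun t => ?_⟩
    rw [hyz]
    exact ((hconv (T + 1)).summable (z := ((t : ℝ) : ℂ)) (by
      rw [Complex.norm_real, Real.norm_of_nonneg t.2.1]; linarith [t.2.2])).hasSum

end

end LFractional

/-- The functions `t^k 𝓔_α^{(k)}(μ_l t)`, `k < n_l`, are a basis of the solution space: they are
linearly independent and their span is the set of solutions. This is stated for both readings of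
"solution" (almost everywhere in the absolutely continuous class, and everywhere in the class of
power series); in particular both sets are the same vector space. -/
theorem mainTheorem3 (α : ℝ) (hα0 : 0 < α) (hα1 : α < 1) (T : ℝ) (hT : 0 < T)
    (m : ℕ) (hm : 1 ≤ m) (a : Fin m → ℂ)
    (r : ℕ) (μ : Fin r → ℂ) (hμ : Function.Injective μ) (n : Fin r → ℕ) (hn : ∀ l, 1 ≤ n l)
    (hp : (Polynomial.X ^ m + ∑ i : Fin m, Polynomial.C (a i) * Polynomial.X ^ (i : ℕ) :
        Polynomial ℂ) = ∏ l : Fin r, (Polynomial.X - Polynomial.C (μ l)) ^ n l) :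
    LinearIndependent ℂ
      (fun p : (Σ l : Fin r, Fin (n l)) => LFractional.basisFun T α (μ p.1) p.2) ∧
    (Submodule.span ℂ (Set.range
      (fun p : (Σ l : Fin r, Fin (n l)) => LFractional.basisFun T α (μ p.1) p.2)) :
        Set (Set.Icc (0 : ℝ) T → ℂ)) = LFractional.solutions hT α a ∧
    (Submodule.span ℂ (Set.range
      (fun p : (Σ l : Fin r, Fin (n l)) => LFractional.basisFun T α (μ p.1) p.2)) :
        Set (Set.Icc (0 : ℝ) T → ℂ)) = LFractional.analyticSolutions hT α a :=
  ⟨LFractional.linearIndependent_basisFun hα0 hα1 hT hμ,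
    LFractional.span_eq_solutions hα0 hα1 hT hm hμ hp,
    LFractional.span_eq_analyticSolutions hα0 hα1 hT hμ hp⟩
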